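/- **Notation.** For an $n\times n$ real matrix $A$, $\triangle_n$ is the simplex of mixed strategies and $(x,y)\in\triangle_n^2$ is a Nash equilibrium of the zero-sum game $A$ if $\langle x',Ay\rangle\le\langle x,Ay\rangle\le\langle x,Ay'\rangle$ for all $x',y'\in\triangle_n$. Let $M_A$ be the $n\times n$ matrix with $(M_A)_{i,j}=A_{1,j}-A_{i+1,j}$ for $i\le n-1$ and $(M_A)_{n,j}=1$, and let $M_{A,\ell}$ be $M_A$ with its $\ell$-th column replaced by $(0,\dots,0,1)^\top$. Put $$\Delta_{\min}=\min\Big\{\min_{i}|\det M_{A^\top,i}|,\ \min_j|\det M_{A,j}|\Big\},\qquad D=\det M_{A^\top}.$$ **Game.** Let $A\in[0,1]^{n\times n}$. In each round $t=1,\dots,T$ the row player chooses $x_t\in\triangle_n$ and an adversary chooses $y_t\in\triangle_n$, where $y_t$ may depend in any (measurable) way on everything that happened before round $t$ (including the knowledge of $A$ and $x_t$). Then $\mathbf A_t\in[0,1]^{n\times n}$ is drawn, the $\mathbf A_t$ being i.i.d. with mean $A$ and $\mathbf A_t$ independent of the past, and a column $j_t$ is drawn from $y_t$. The row player observes $\mathbf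 A_t$ and $j_t$ (full feedback). It knows $n$ and $T$, but not $A$. **Subroutine** with input $x',\widehat A,D_1,T_1,T_2$. Put $\eta=\frac1{D_1T_1}$, $r=\frac1{D_1\sqrt{T_1}}$, and $\delta(i)=-r$ for $i\le n-1$. For $T_2$ rounds: play $x'+\big(\delta(1),\dots,\delta(n-1),-\sum_{i<n}\delta(i)\big)$; if this vector is not in $\triangle_n$ (or if $D_1=0$, so that it is not defined), play $x'$; observe the column $j$ and, for every $i\le n-1$, replace $\delta(i)$ by the projection of $\delta(i)+\eta(\widehat A_{i,j}-\widehat A_{n,j})$ onto $[-r,r]$. **Algorithm.** Let $\bar A$ always denote the mean of the matrices observed so far. Fix any measurable rule that selects a Nash equilibrium of every matrix; "the" equilibrium of $\bar A$ is the selected one. Start with $x_1=(1/n,\dots,1/n)$ and $t_*=T+1$. At the end of each round $t$ let $x_{t+1}$ be the row strategy of the equilibrium of $\bar A$, $\Delta=\sqrt{2\log(n^2T^2)/t}$, and let $\tilde\Delta_{\min}$ be the minimum of $|\det M_{\bar A^\top}|$, $|\det M_{\bar A}|$, $\min_i|\det M_{\bar A^\top,i}|$ and $\min_j|\det M_{\bar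 A,j}|$. If $1\le\frac{\tilde\Delta_{\min}+2n^2n!\Delta}{\tilde\Delta_{\min}-2n^2n!\Delta}\le\frac32$ and $t_*>T$, set $t_*=6.25\,t$. At the first $t\le T$ with $t\ge t_*$: * if $\bar A$ has a unique Nash equilibrium and it has full support, set $t_1=t$ and, while $t_1<T$: run the subroutine with $x'$ the row strategy of the equilibrium of the current $\bar A$, $\widehat A=\bar A$, $D_1=\frac{|\det M_{\bar A^\top}|}{5n\,n!}$, $T_1=\frac{t_1}{2\log(n^2T^2)}$, $T_2=\min\{t_1,T-t_1\}$, and then replace $t_1$ by $2t_1$; * otherwise keep playing, in every remaining round, the row strategy of the equilibrium of the current $\bar A$. **Theorem.** There are absolute constants $c_1,c_2>0$ such that for all $n,T\ge1$, every $A\in[0,1]^{n\times n}$ that has a unique Nash equilibrium $(x^*,y^*)$, with $(x^*,y^*)$ of full support, and every adversary, the strategies $x_t$ of the algorithm satisfy $$T\,\langle x^*,Ay^*\rangle-\sum_{t=1}^T\mathbb E\big[\langle x_t,Ay_t\rangle\big]\ \le\ \frac{c_1\,n^2\,n!\,\log(nT)}{\Delta_{\min}}+\frac{c_2\,n^2\,n!\,(\log(nT))^2}{|D|},$$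 where the expectations exist. -/

import Mathlib

open MeasureTheory ProbabilityTheory
open scoped Matrix

noncomputable section

namespace MatrixGame

/-- `(x, y)` is a Nash equilibrium of the zero-sum game `A` (the row player maximises):
`⟨x', A y⟩ ≤ ⟨x, A y⟩ ≤ ⟨x, A y'⟩` for all mixed strategies `x'`, `y'`. -/
def IsNash {n : ℕ} (A : Matrix (Fin n) (Fin n) ℝ) (x y : Fin n → ℝ) : Prop :=
  x ∈ stdSimplex ℝ (Fin n) ∧ y ∈ stdSimplex ℝ (Fin n) ∧
    (∀ x' ∈ stdSimplex ℝ (Fin n), x' ⬝ᵥ (A *ᵥ y) ≤ x ⬝ᵥ (A *ᵥ y)) ∧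
    (∀ y' ∈ stdSimplex ℝ (Fin n), x ⬝ᵥ (A *ᵥ y) ≤ x ⬝ᵥ (A *ᵥ y'))

/-- `(x, y)` is the only Nash equilibrium of `A`, and both strategies have full support. -/
def IsUniqueFullNash {n : ℕ} (A : Matrix (Fin n) (Fin n) ℝ) (x y : Fin n → ℝ) : Prop :=
  IsNash A x y ∧ (∀ x' y', IsNash A x' y' → x' = x ∧ y' = y) ∧
    (∀ i, 0 < x i) ∧ (∀ j, 0 < y j)

/-- The game `A` has a unique Nash equilibrium, and that equilibrium has full support. -/
def HasUniqueFullNash {n : ℕ} (A : Matrix (Fin n) (Fin n) ℝ) : Prop :=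
  ∃ x y, IsUniqueFullNash A x y

/-! ### Cramer determinants -/

/-- The matrix `M_A`: its `i`-th row is (first row of `A`) minus (row `i + 1` of `A`) for every
row but the last, and its last row is `(1, …, 1)`. -/
def cramerMat {n : ℕ} (A : Matrix (Fin n) (Fin n) ℝ) : Matrix (Fin n) (Fin n) ℝ :=
  Matrix.of fun i j =>
    if h : (i : ℕ) + 1 < n then A ⟨0, by omega⟩ j - A ⟨(i : ℕ) + 1, h⟩ j else 1

/-- The vector `b = (0, …, 0, 1)`. -/
def cramerVec (n : ℕ) : Fin n → ℝ := fun i => if (i : ℕ) + 1 < n then 0 else 1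

/-- The matrix `M_{A,ℓ}`: column `ℓ` of `M_A` is replaced by `b`. -/
def cramerMatCol {n : ℕ} (A : Matrix (Fin n) (Fin n) ℝ) (l : Fin n) :
    Matrix (Fin n) (Fin n) ℝ :=
  (cramerMat A).updateCol l (cramerVec n)

/-- `Δ_min = min { min_i |det M_{Aᵀ,i}|, min_j |det M_{A,j}| }`. -/
def deltaMin {n : ℕ} (A : Matrix (Fin n) (Fin n) ℝ) : ℝ :=
  min (⨅ i, |(cramerMatCol Aᵀ i).det|) (⨅ j, |(cramerMatCol A j).det|)

/-- `D = det M_{Aᵀ}`. -/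
def cramerD {n : ℕ} (A : Matrix (Fin n) (Fin n) ℝ) : ℝ := (cramerMat Aᵀ).det

/-- `Δ̃_min`, the quantity that the algorithm computes from the empirical matrix. -/
def deltaMinTilde {n : ℕ} (A : Matrix (Fin n) (Fin n) ℝ) : ℝ :=
  min (min |(cramerMat Aᵀ).det| |(cramerMat A).det|) (deltaMin A)

/-! ### The subroutine (full feedback) -/

/-- The input parameters `x'`, `Â`, `D₁`, `T₁`, `T₂` of the subroutine. -/
structure SubParams (n : ℕ) where
  x' : Fin n → ℝ
  Ahat : Matrix (Fin n) (Fin n) ℝ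
  D₁ : ℝ
  T₁ : ℝ
  T₂ : ℕ

namespace SubParams

variable {n : ℕ}

/-- The half-width `1 / (D₁ √T₁)` of the interval to which each `δ_t(i)` is confined. -/
def radius (p : SubParams n) : ℝ := 1 / (p.D₁ * Real.sqrt p.T₁)

/-- The step size `η = 1 / (D₁ T₁)`. -/
def eta (p : SubParams n) : ℝ := 1 / (p.D₁ * p.T₁)

/-- The initial value of `δ`. Only the first `n - 1` coordinates of `δ` are ever used. -/
def init (p : SubParams n) : Fin n → ℝ := fun _ => -p.radius

/-- The vector `(δ(1), …, δ(n-1), -∑_{i<n} δ(i))`. -/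
def fullDelta (δ : Fin n → ℝ) : Fin n → ℝ := fun i =>
  if (i : ℕ) + 1 < n then δ i
  else -∑ k ∈ Finset.univ.filter (fun k : Fin n => (k : ℕ) + 1 < n), δ k

open Classical in
/-- The strategy `x' + (δ(1), …, δ(n-1), -∑ δ(i))` of the subroutine. The row player can only play
points of the simplex: if this vector is not one, then `x'` is played. -/
def play (p : SubParams n) (δ : Fin n → ℝ) : Fin n → ℝ :=
  if p.x' + fullDelta δ ∈ stdSimplex ℝ (Fin n) then p.x' + fullDelta δ else p.x'

/-- The update of `δ` after column `j` was observed: a step `η (Â_{i,j} - Â_{n,j})`, followed by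
the projection onto the interval `[-1/(D₁√T₁), 1/(D₁√T₁)]`. -/
def update (p : SubParams n) (δ : Fin n → ℝ) (j : Fin n) : Fin n → ℝ := fun i =>
  max (-p.radius) (min p.radius
    (δ i + p.eta * (p.Ahat i j - p.Ahat ⟨n - 1, by have := i.isLt; omega⟩ j)))

end SubParams

/-! ### The main algorithm -/

/-- The confidence width `√(2 log(n² T²) / t)`. -/
def confWidth (n T t : ℕ) : ℝ := Real.sqrt (2 * Real.log ((n : ℝ) ^ 2 * (T : ℝ) ^ 2) / t)

/-- The test `1 ≤ (Δ̃_min + 2 n² n! Δ) / (Δ̃_min - 2 n² n! Δ) ≤ 3/2` made at the end of round `t`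
on the empirical matrix `Abar`. -/
def StopTest {n : ℕ} (T t : ℕ) (Abar : Matrix (Fin n) (Fin n) ℝ) : Prop :=
  let w : ℝ := 2 * (n : ℝ) ^ 2 * (n.factorial : ℝ) * confWidth n T t
  1 ≤ (deltaMinTilde Abar + w) / (deltaMinTilde Abar - w) ∧
    (deltaMinTilde Abar + w) / (deltaMinTilde Abar - w) ≤ 3 / 2

/-- What the algorithm is doing: the initial loop (`explore`), the final loop that plays empirical
equilibria until round `T` (`plugIn`), or a call of the subroutine (`sub`). -/
inductive Phase
  | explore
  | plugIn
  | sub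

/-- The memory of the algorithm between two rounds. -/
structure AlgState (n : ℕ) where
  /-- number `t` of completed rounds -/
  rounds : ℕ
  /-- sum of the matrices observed so far, so that the empirical mean is `total / rounds` -/
  total : Matrix (Fin n) (Fin n) ℝ
  /-- the variable `t_*` -/
  tstar : ℝ
  phase : Phase
  /-- the strategy `x_{t+1}`, outside the subroutine -/
  next : Fin n → ℝ
  /-- the variable `t₁` of the doubling loop -/
  t₁ : ℕ
  /-- parameters of the current call of the subroutine -/
  par : SubParams n
  /-- the current `δ` of the subroutine -/
  δ : Fin n → ℝ
  /-- how often each entry was observed in the current call of the subroutine; under full feedback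
  this is the same number for all entries -/
  obs : ℕ

variable {n : ℕ}

/-- The parameters with which the subroutine is called at `t₁`: `x'` is the row strategy of the
equilibrium of the empirical matrix `Abar`, `Â = Abar`, `D₁ = |det M_{Abarᵀ}| / (5 n n!)`,
`T₁ = (1/Δ)²` with `Δ = √(2 log(n²T²)/t₁)`, and `T₂ = min {t₁, T - t₁}`. -/
def subCall (nash : Matrix (Fin n) (Fin n) ℝ → (Fin n → ℝ) × (Fin n → ℝ)) (T t₁ : ℕ)
    (Abar : Matrix (Fin n) (Fin n) ℝ) : SubParams n where
  x' := (nash Abar).1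
  Ahat := Abar
  D₁ := |(cramerMat Abarᵀ).det| / (5 * n * n.factorial)
  T₁ := (1 / confWidth n T t₁) ^ 2
  T₂ := min t₁ (T - t₁)

/-- The state before the first round: `x₁` is uniform and `t_* = T + 1`. The fields of the
subroutine are placeholders until its first call. -/
def initState (n T : ℕ) : AlgState n where
  rounds := 0
  total := 0
  tstar := (T : ℝ) + 1
  phase := Phase.explore
  next := fun _ => 1 / (n : ℝ)
  t₁ := 0
  par := ⟨0, 0, 0, 0, 0⟩
  δ := 0
  obs := 0

/-- The strategy for the next round. -/
def AlgState.play (s : AlgState n) : Fin n → ℝ :=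
  match s.phase with
  | Phase.explore => s.next
  | Phase.plugIn => s.next
  | Phase.sub => s.par.play s.δ

/-- Start a call of the subroutine at `t₁` from the state `s`. -/
def AlgState.callSub (nash : Matrix (Fin n) (Fin n) ℝ → (Fin n → ℝ) × (Fin n → ℝ)) (T t₁ : ℕ)
    (Abar : Matrix (Fin n) (Fin n) ℝ) (s : AlgState n) : AlgState n :=
  { s with
    phase := Phase.sub
    t₁ := t₁
    par := subCall nash T t₁ Abar
    δ := (subCall nash T t₁ Abar).init
    obs := 0 }

open Classical in
/-- The value of `t_*` after the test made at the end of round `t`. -/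
def tstarUpdate (T t : ℕ) (Abar : Matrix (Fin n) (Fin n) ℝ) (tstar : ℝ) : ℝ :=
  if StopTest T t Abar ∧ (T : ℝ) < tstar then (25 / 4 : ℝ) * t else tstar

open Classical in
/-- What the algorithm does at the end of a round in which it observed the matrix `B` and the column
`j`. It stops after round `T`, so that its states after that round are immaterial. -/
def AlgState.step (nash : Matrix (Fin n) (Fin n) ℝ → (Fin n → ℝ) × (Fin n → ℝ)) (T : ℕ)
    (s : AlgState n) (B : Matrix (Fin n) (Fin n) ℝ) (j : Fin n) : AlgState n :=
  let t : ℕ := s.rounds + 1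
  let Abar : Matrix (Fin n) (Fin n) ℝ := (1 / (t : ℝ)) • (s.total + B)
  let s' : AlgState n :=
    { s with rounds := t, total := s.total + B, next := (nash Abar).1 }
  match s.phase with
  | Phase.explore =>
    let tstar : ℝ := tstarUpdate T t Abar s.tstar
    if tstar ≤ t ∧ HasUniqueFullNash Abar then
      AlgState.callSub nash T t Abar { s' with tstar := tstar }
    else if tstar ≤ t then
      { s' with tstar := tstar, phase := Phase.plugIn }
    else
      { s' with tstar := tstar }
  | Phase.plugIn => s'
  | Phase.sub =>
    if s.par.T₂ ≤ s.obs + 1 then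
      AlgState.callSub nash T (2 * s.t₁) Abar s'
    else
      { s' with δ := s.par.update s.δ j, obs := s.obs + 1 }

/-- The state after `t` rounds, when the matrices `B 0, …, B (t-1)` and the columns
`j 0, …, j (t-1)` have been observed. -/
def algState (nash : Matrix (Fin n) (Fin n) ℝ → (Fin n → ℝ) × (Fin n → ℝ)) (T : ℕ)
    (B : ℕ → Matrix (Fin n) (Fin n) ℝ) (j : ℕ → Fin n) : ℕ → AlgState n
  | 0 => initState n T
  | t + 1 => (algState nash T B j t).step nash T (B t) (j t)

/-- The mixed strategy of the algorithm in round `t` (rounds are numbered `0, …, T - 1`); it depends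
only on what was observed in the rounds before `t`. -/
def algPlay (nash : Matrix (Fin n) (Fin n) ℝ → (Fin n → ℝ) × (Fin n → ℝ)) (T : ℕ)
    (B : ℕ → Matrix (Fin n) (Fin n) ℝ) (j : ℕ → Fin n) (t : ℕ) : Fin n → ℝ :=
  (algState nash T B j t).play

/-! ### The repeated game -/

/-- `T` rounds (numbered `0, …, T - 1`) of the repeated game with full feedback on the mean matrix
`A`. The σ-algebra `ℱ t` is everything that has happened before round `t`; besides the observed
matrices and columns it may hold the realised rows of the row player, private randomness of the
adversary, or anything else. In round `t` the adversary plays the mixed strategy `y t`, which may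
depend on `ℱ t` in any way; `B t` is the random matrix and `j t` the realised column. -/
structure IsFullFeedbackGame {Ω : Type*} {mΩ : MeasurableSpace Ω} (μ : Measure Ω)
    (ℱ : Filtration ℕ mΩ) (A : Matrix (Fin n) (Fin n) ℝ) (T : ℕ)
    (B : ℕ → Ω → Matrix (Fin n) (Fin n) ℝ) (j : ℕ → Ω → Fin n)
    (y : ℕ → Ω → Fin n → ℝ) : Prop where
  /-- the matrix of round `t` is known after round `t` -/
  measurable_matrix : ∀ t < T, ∀ i k, Measurable[ℱ (t + 1)] fun ω => B t ω i k
  /-- the matrices have entries in `[0, 1]` -/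
  matrix_mem : ∀ t < T, ∀ ω i k, B t ω i k ∈ Set.Icc (0 : ℝ) 1
  /-- the matrices have mean `A` -/
  mean : ∀ t < T, ∀ i k, ∫ ω, B t ω i k ∂μ = A i k
  /-- the matrix of round `t` is independent of the past -/
  indep : ∀ t < T, Indep (MeasurableSpace.comap (fun ω (q : Fin n × Fin n) => B t ω q.1 q.2)
    inferInstance) (ℱ t) μ
  /-- the matrices are identically distributed -/
  identDistrib : ∀ t < T, IdentDistrib (fun ω (q : Fin n × Fin n) => B t ω q.1 q.2)
    (fun ω (q : Fin n × Fin n) => B 0 ω q.1 q.2) μ μ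
  /-- the adversary's strategy is a function of the past -/
  measurable_adv : ∀ t < T, Measurable[ℱ t] (y t)
  /-- the adversary plays mixed strategies -/
  adv_mem : ∀ t < T, ∀ ω, y t ω ∈ stdSimplex ℝ (Fin n)
  /-- the realised column of round `t` is known after round `t` -/
  measurable_col : ∀ t < T, Measurable[ℱ (t + 1)] (j t)
  /-- given the past, the column of round `t` is drawn from `y t` -/
  col_law : ∀ t < T, ∀ k,
    μ[(j t ⁻¹' {k}).indicator (fun _ => (1 : ℝ)) | ℱ t] =ᵐ[μ] fun ω => y t ω k

end MatrixGame

end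

namespace MatrixGame

/-! ### Perturbation of determinants -/

/-! Write w_t = 2√(log(nT)/t) for the confidence width, N = n² n!, and v for the value of `A`. By
Hoeffding and a union bound, with probability at least 1 - 2/T every empirical mean up to the
horizon is entrywise within w_t of `A` (`measure_badEvent_le`). The complementary event costs at
most 2 in expectation, since the regret never exceeds T. Since x_t is determined before the column
is drawn, ⟨x_t, A y_t⟩ may be replaced under the expectation by the payoff against the realised
column (`integral_payoff_eq`). What remains is a deterministic bound on every accurate path
(`GoodPath.regret_le`).

Equilibria of full support are governed by linear algebra: both strategies equalise the payoffs, so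
they solve M z = b and are given by Cramer's rule (`hasUniqueFullNash_iff`). The determinants
involved move by at most 2 n n! e when the entries of the game move by e. Hence Δ̃_min is a
Lipschitz measure of how robust the uniqueness and full support are.

Exploration. An equilibrium of an e-close game loses at most 2e against any column
(`Close.value_sub_le_vecMul`), so t rounds cost O(√(t log(nT))). A negative test in round τ forces
Δ_min ≤ 12 N w_τ, which bounds √t by O(N √log(nT) / Δ_min). The two estimates multiply to the first
term of the theorem (`GoodPath.explore_le`).

Subroutine. After t_* one has Δ̃_min(A) ≥ 20 N w_t. Then the empirical game also has a unique
equilibrium of full support, the true x* lies in the box of radius r around the empirical x', and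
the whole box, completed by the last coordinate, stays in the simplex (`Accurate.abs_comparator_le`,
`Accurate.play_eq`). Since x* equalises the columns of `A`, the regret against a column is linear in
x* - x_t, and projected gradient ascent with comparator x* - x' controls it. Using the empirical
matrix in place of `A` costs only (box size) × (matrix error), of order w_t²/D₁ per coordinate and
round. Over at most t rounds each contribution is O(n log(nT)/D₁), that is O(N log(nT)/|D|)
(`Accurate.regret_step`, `Accurate.budget_le`). Doubling t₁ allows only O(log T) calls, which gives
the second term. The invariant `PathInv` carries this accounting through the states of the
algorithm. -/

lemma abs_prod_sub_prod_le {ι : Type*} (s : Finset ι) {f g : ι → ℝ} (hf : ∀ i, |f i| ≤ 1)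
    (hg : ∀ i, |g i| ≤ 1) : |∏ i ∈ s, f i - ∏ i ∈ s, g i| ≤ ∑ i ∈ s, |f i - g i| := by
  classical
  induction s using Finset.induction_on with
  | empty => simp
  | insert a s ha ih =>
    rw [Finset.prod_insert ha, Finset.prod_insert ha, Finset.sum_insert ha]
    have hP : |∏ i ∈ s, f i| ≤ 1 := by
      rw [Finset.abs_prod]
      exact Finset.prod_le_one (fun _ _ => abs_nonneg _) fun i _ => hf i
    calc |f a * ∏ i ∈ s, f i - g a * ∏ i ∈ s, g i|
        = |(f a - g a) * ∏ i ∈ s, f i + g a * (∏ i ∈ s, f i - ∏ i ∈ s, g i)| := by ring_nf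
      _ ≤ |(f a - g a) * ∏ i ∈ s, f i| + |g a * (∏ i ∈ s, f i - ∏ i ∈ s, g i)| := abs_add_le _ _
      _ ≤ |f a - g a| * 1 + 1 * |∏ i ∈ s, f i - ∏ i ∈ s, g i| := by
        rw [abs_mul, abs_mul]
        gcongr
        exact hg a
      _ ≤ _ := by rw [mul_one, one_mul]; gcongr

variable {n : ℕ}

/-- In the Leibniz expansion each of the n! products changes by at most n e, by telescoping over its
factors. -/
lemma abs_det_sub_det_le {P Q : Matrix (Fin n) (Fin n) ℝ} {e : ℝ} (hP : ∀ i j, |P i j| ≤ 1)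
    (hQ : ∀ i j, |Q i j| ≤ 1) (h : ∀ i j, |P i j - Q i j| ≤ e) :
    |P.det - Q.det| ≤ n * n.factorial * e := by
  rw [Matrix.det_apply', Matrix.det_apply', ← Finset.sum_sub_distrib]
  refine (Finset.abs_sum_le_sum_abs _ _).trans ?_
  have key : ∀ σ ∈ (Finset.univ : Finset (Equiv.Perm (Fin n))),
      |((Equiv.Perm.sign σ : ℤ) : ℝ) * ∏ i, P (σ i) i
        - ((Equiv.Perm.sign σ : ℤ) : ℝ) * ∏ i, Q (σ i) i| ≤ n * e := by
    intro σ _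
    rw [← mul_sub, abs_mul]
    have h1 : |((Equiv.Perm.sign σ : ℤ) : ℝ)| = 1 := by
      rcases Int.units_eq_one_or (Equiv.Perm.sign σ) with h | h <;> simp [h]
    rw [h1, one_mul]
    refine (abs_prod_sub_prod_le _ (fun i => hP _ _) fun i => hQ _ _).trans ?_
    refine (Finset.sum_le_card_nsmul _ _ e fun i _ => h _ _).trans ?_
    simp
  refine (Finset.sum_le_card_nsmul _ _ _ key).trans ?_
  rw [Finset.card_univ, Fintype.card_perm, Fintype.card_fin, nsmul_eq_mul]
  exact le_of_eq (by ring)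

lemma abs_det_le_factorial {P : Matrix (Fin n) (Fin n) ℝ} (hP : ∀ i j, |P i j| ≤ 1) :
    |P.det| ≤ n.factorial := by
  have := Matrix.det_le (A := P) (abv := AbsoluteValue.abs) (x := 1) hP
  simpa using this

/-- A quantitative form of the uniqueness of solutions of linear systems. -/
lemma abs_det_mul_abs_le {P : Matrix (Fin n) (Fin n) ℝ} {z : Fin n → ℝ} {e : ℝ}
    (hP : ∀ i j, |P i j| ≤ 1) (h : ∀ i, |(P *ᵥ z) i| ≤ e) (i : Fin n) :
    |P.det| * |z i| ≤ n * n.factorial * e := by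
  -- The adjugate inverts the system up to the determinant, and its entries are determinants of
  -- matrices with entries in [-1, 1], hence at most n! in absolute value.
  have h1 : P.adjugate *ᵥ (P *ᵥ z) = P.det • z := by
    rw [Matrix.mulVec_mulVec, Matrix.adjugate_mul, Matrix.smul_mulVec, Matrix.one_mulVec]
  have h2 := congrFun h1 i
  rw [Pi.smul_apply, smul_eq_mul] at h2
  rw [← abs_mul, ← h2, Matrix.mulVec, dotProduct]
  refine (Finset.abs_sum_le_sum_abs _ _).trans ?_
  refine (Finset.sum_le_card_nsmul _ _ (n.factorial * e) fun j _ => ?_).trans ?_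
  · rw [abs_mul]
    gcongr
    · rw [Matrix.adjugate_apply]
      refine abs_det_le_factorial fun k l => ?_
      rw [Matrix.updateRow_apply]
      split_ifs with hk
      · rw [Pi.single_apply]; split_ifs <;> simp
      · exact hP k l
    · exact h j
  · rw [Finset.card_univ, Fintype.card_fin, nsmul_eq_mul]
    exact le_of_eq (by ring)

lemma abs_cramerMat_le {A : Matrix (Fin n) (Fin n) ℝ} (hA : ∀ i k, A i k ∈ Set.Icc (0 : ℝ) 1)
    (i j : Fin n) : |cramerMat A i j| ≤ 1 := by
  rw [cramerMat, Matrix.of_apply]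
  split_ifs with h
  · have h1 := hA ⟨0, by omega⟩ j
    have h2 := hA ⟨(i : ℕ) + 1, h⟩ j
    rw [abs_le]; constructor <;> linarith [h1.1, h1.2, h2.1, h2.2]
  · simp

lemma abs_cramerMat_sub_le {A A' : Matrix (Fin n) (Fin n) ℝ} {e : ℝ} (he : 0 ≤ e)
    (h : ∀ i k, |A' i k - A i k| ≤ e) (i j : Fin n) :
    |cramerMat A' i j - cramerMat A i j| ≤ 2 * e := by
  rw [cramerMat, Matrix.of_apply, cramerMat, Matrix.of_apply]
  split_ifs with hi
  · have h1 := abs_le.1 (h ⟨0, by omega⟩ j)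
    have h2 := abs_le.1 (h ⟨(i : ℕ) + 1, hi⟩ j)
    rw [abs_le]; constructor <;> linarith [h1.1, h1.2, h2.1, h2.2]
  · simpa using he

lemma abs_cramerMatCol_le {A : Matrix (Fin n) (Fin n) ℝ} (hA : ∀ i k, A i k ∈ Set.Icc (0 : ℝ) 1)
    (l i j : Fin n) : |cramerMatCol A l i j| ≤ 1 := by
  rw [cramerMatCol, Matrix.updateCol_apply]
  split_ifs with h
  · rw [cramerVec]; split_ifs <;> simp
  · exact abs_cramerMat_le hA i j

lemma abs_cramerMatCol_sub_le {A A' : Matrix (Fin n) (Fin n) ℝ} {e : ℝ} (he : 0 ≤ e)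
    (h : ∀ i k, |A' i k - A i k| ≤ e) (l i j : Fin n) :
    |cramerMatCol A' l i j - cramerMatCol A l i j| ≤ 2 * e := by
  rw [cramerMatCol, Matrix.updateCol_apply, cramerMatCol, Matrix.updateCol_apply]
  split_ifs with hi
  · simpa using he
  · exact abs_cramerMat_sub_le he h i j

/-- Closeness of two games with payoffs in `[0, 1]`. -/
structure Close (A A' : Matrix (Fin n) (Fin n) ℝ) (e : ℝ) : Prop where
  nonneg : 0 ≤ e
  left_mem : ∀ i k, A i k ∈ Set.Icc (0 : ℝ) 1
  right_mem : ∀ i k, A' i k ∈ Set.Icc (0 : ℝ) 1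
  abs_sub_le : ∀ i k, |A' i k - A i k| ≤ e

namespace Close

variable {A A' : Matrix (Fin n) (Fin n) ℝ} {e : ℝ}

lemma transpose (h : Close A A' e) : Close Aᵀ A'ᵀ e :=
  ⟨h.nonneg, fun i k => h.left_mem k i, fun i k => h.right_mem k i, fun i k => h.abs_sub_le k i⟩

lemma symm (h : Close A A' e) : Close A' A e :=
  ⟨h.nonneg, h.right_mem, h.left_mem, fun i k => by rw [abs_sub_comm]; exact h.abs_sub_le i k⟩

lemma abs_det_sub_le (h : Close A A' e) :
    |(cramerMat A').det - (cramerMat A).det| ≤ 2 * n * n.factorial * e :=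
  (abs_det_sub_det_le (abs_cramerMat_le h.right_mem) (abs_cramerMat_le h.left_mem)
    (abs_cramerMat_sub_le h.nonneg h.abs_sub_le)).trans (le_of_eq (by ring))

lemma abs_detCol_sub_le (h : Close A A' e) (l : Fin n) :
    |(cramerMatCol A' l).det - (cramerMatCol A l).det| ≤ 2 * n * n.factorial * e :=
  (abs_det_sub_det_le (abs_cramerMatCol_le h.right_mem l) (abs_cramerMatCol_le h.left_mem l)
    (abs_cramerMatCol_sub_le h.nonneg h.abs_sub_le l)).trans (le_of_eq (by ring))

end Close

lemma le_deltaMin_iff [NeZero n] {A : Matrix (Fin n) (Fin n) ℝ} {c : ℝ} :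
    c ≤ deltaMin A ↔
      (∀ i, c ≤ |(cramerMatCol Aᵀ i).det|) ∧ ∀ j, c ≤ |(cramerMatCol A j).det| := by
  rw [deltaMin, le_min_iff, le_ciInf_iff (Set.finite_range _).bddBelow,
    le_ciInf_iff (Set.finite_range _).bddBelow]

lemma le_deltaMinTilde_iff [NeZero n] {A : Matrix (Fin n) (Fin n) ℝ} {c : ℝ} :
    c ≤ deltaMinTilde A ↔
      c ≤ |(cramerMat Aᵀ).det| ∧ c ≤ |(cramerMat A).det| ∧
      (∀ i, c ≤ |(cramerMatCol Aᵀ i).det|) ∧ ∀ j, c ≤ |(cramerMatCol A j).det| := by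
  rw [deltaMinTilde, le_min_iff, le_min_iff, le_deltaMin_iff, and_assoc]

lemma Close.deltaMinTilde_le [NeZero n] {A A' : Matrix (Fin n) (Fin n) ℝ} {e : ℝ}
    (h : Close A A' e) : deltaMinTilde A - 2 * n * n.factorial * e ≤ deltaMinTilde A' := by
  obtain ⟨h1, h2, h3, h4⟩ := le_deltaMinTilde_iff.1 (le_refl (deltaMinTilde A))
  have key : ∀ {a b : ℝ}, deltaMinTilde A ≤ |a| → |b - a| ≤ 2 * n * n.factorial * e →
      deltaMinTilde A - 2 * n * n.factorial * e ≤ |b| := by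
    intro a b ha hb
    have := abs_sub_abs_le_abs_sub a b
    rw [abs_sub_comm] at this
    linarith
  exact le_deltaMinTilde_iff.2 ⟨key h1 h.transpose.abs_det_sub_le, key h2 h.abs_det_sub_le,
    fun i => key (h3 i) (h.transpose.abs_detCol_sub_le i),
    fun i => key (h4 i) (h.abs_detCol_sub_le i)⟩

/-- It keeps n!/Δ_min at least 1, so that absolute constants can be absorbed into the main term. -/
lemma deltaMin_le_factorial [NeZero n] {A : Matrix (Fin n) (Fin n) ℝ}
    (hA : ∀ i k, A i k ∈ Set.Icc (0 : ℝ) 1) : deltaMin A ≤ n.factorial :=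
  ((le_deltaMin_iff.1 le_rfl).2 0).trans (abs_det_le_factorial (abs_cramerMatCol_le hA 0))

/-! ### Nash equilibria of full support -/

lemma IsNash.mulVec_le {A : Matrix (Fin n) (Fin n) ℝ} {x y : Fin n → ℝ} (h : IsNash A x y)
    (i : Fin n) : (A *ᵥ y) i ≤ x ⬝ᵥ (A *ᵥ y) := by
  have := h.2.2.1 (Pi.single i 1) (single_mem_stdSimplex ℝ i)
  simpa using this

lemma IsNash.le_vecMul {A : Matrix (Fin n) (Fin n) ℝ} {x y : Fin n → ℝ} (h : IsNash A x y)
    (j : Fin n) : x ⬝ᵥ (A *ᵥ y) ≤ (x ᵥ* A) j := by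
  have := h.2.2.2 (Pi.single j 1) (single_mem_stdSimplex ℝ j)
  rw [Matrix.dotProduct_mulVec x A (Pi.single j 1)] at this
  simpa using this

lemma dotProduct_of_mem_stdSimplex {x w : Fin n → ℝ} {v : ℝ} (hx : x ∈ stdSimplex ℝ (Fin n))
    (hw : ∀ i, w i = v) : x ⬝ᵥ w = v := by
  rw [dotProduct, Finset.sum_congr rfl fun i _ => by rw [hw i], ← Finset.sum_mul, hx.2, one_mul]

lemma eq_of_dotProduct_eq_of_le {x w : Fin n → ℝ} {v : ℝ} (hx : x ∈ stdSimplex ℝ (Fin n))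
    (hpos : ∀ i, 0 < x i) (hw : ∀ i, v ≤ w i) (h : x ⬝ᵥ w = v) (i : Fin n) : w i = v := by
  have h0 : ∑ i, x i * (w i - v) = 0 := by
    simp_rw [mul_sub, Finset.sum_sub_distrib]
    rw [← Finset.sum_mul, hx.2, one_mul]
    exact sub_eq_zero.2 h
  have := (Finset.sum_eq_zero_iff_of_nonneg fun i _ =>
    mul_nonneg (hpos i).le (sub_nonneg.2 (hw i))).1 h0 i (Finset.mem_univ i)
  rcases mul_eq_zero.1 this with h' | h'
  · exact absurd h' (hpos i).ne'
  · linarith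

lemma isNash_of_equalizing {A : Matrix (Fin n) (Fin n) ℝ} {x y : Fin n → ℝ} {v w : ℝ}
    (hx : x ∈ stdSimplex ℝ (Fin n)) (hy : y ∈ stdSimplex ℝ (Fin n))
    (hAy : ∀ i, (A *ᵥ y) i = v) (hxA : ∀ j, (x ᵥ* A) j = w) : IsNash A x y := by
  refine ⟨hx, hy, fun x' hx' => ?_, fun y' hy' => ?_⟩
  · rw [dotProduct_of_mem_stdSimplex hx' hAy, dotProduct_of_mem_stdSimplex hx hAy]
  · rw [Matrix.dotProduct_mulVec, Matrix.dotProduct_mulVec, dotProduct_comm,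
      dotProduct_of_mem_stdSimplex hy hxA, dotProduct_comm, dotProduct_of_mem_stdSimplex hy' hxA]

/-- The second strategy of an equilibrium and the first strategy of another equilibrium give the
value of the game. -/
lemma IsNash.value_eq {A : Matrix (Fin n) (Fin n) ℝ} {x y x' y' : Fin n → ℝ} (h : IsNash A x y)
    (h' : IsNash A x' y') :
    x' ⬝ᵥ (A *ᵥ y') = x ⬝ᵥ (A *ᵥ y) ∧ x' ⬝ᵥ (A *ᵥ y) = x ⬝ᵥ (A *ᵥ y) ∧
      x ⬝ᵥ (A *ᵥ y') = x ⬝ᵥ (A *ᵥ y) := by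
  have h1 := h.2.2.1 x' h'.1
  have h2 := h.2.2.2 y' h'.2.1
  have h3 := h'.2.2.1 x h.1
  have h4 := h'.2.2.2 y h.2.1
  refine ⟨?_, ?_, ?_⟩ <;> linarith

/-- Complementary slackness: equilibria are interchangeable, so x' against y yields the value. Every
column yields at least the value against x', and y puts weight on every column, so no column can
yield more. -/
lemma IsNash.vecMul_eq_of_full {A : Matrix (Fin n) (Fin n) ℝ} {x y x' y' : Fin n → ℝ}
    (h : IsNash A x y) (hy : ∀ j, 0 < y j) (h' : IsNash A x' y') (j : Fin n) :
    (x' ᵥ* A) j = x ⬝ᵥ (A *ᵥ y) := by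
  obtain ⟨e1, e2, -⟩ := h.value_eq h'
  refine eq_of_dotProduct_eq_of_le h.2.1 hy (fun i => e1 ▸ h'.le_vecMul i) ?_ j
  rw [dotProduct_comm, ← Matrix.dotProduct_mulVec, e2]

lemma IsNash.mulVec_eq_of_full {A : Matrix (Fin n) (Fin n) ℝ} {x y x' y' : Fin n → ℝ}
    (h : IsNash A x y) (hx : ∀ i, 0 < x i) (h' : IsNash A x' y') (i : Fin n) :
    (A *ᵥ y') i = x ⬝ᵥ (A *ᵥ y) := by
  obtain ⟨e1, -, e3⟩ := h.value_eq h'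
  have := eq_of_dotProduct_eq_of_le (w := fun i => -(A *ᵥ y') i) (v := -(x ⬝ᵥ (A *ᵥ y))) h.1 hx
    (fun i => by rw [← e1]; exact neg_le_neg (h'.mulVec_le i)) (by
      rw [← e3]; exact dotProduct_neg x (A *ᵥ y')) i
  simpa using this

/-! ### Full-support equilibria as solutions of linear systems -/

lemma cramerMat_mulVec_eq_iff [NeZero n] {A : Matrix (Fin n) (Fin n) ℝ} {y : Fin n → ℝ} {c : ℝ} :
    cramerMat A *ᵥ y = c • cramerVec n ↔
      (∀ i, (A *ᵥ y) i = (A *ᵥ y) 0) ∧ ∑ i, y i = c := by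
  have hn : 0 < n := Nat.pos_of_ne_zero (NeZero.ne n)
  have row1 : ∀ (i : Fin n) (h : (i : ℕ) + 1 < n),
      (cramerMat A *ᵥ y) i = (A *ᵥ y) 0 - (A *ᵥ y) ⟨(i : ℕ) + 1, h⟩ := by
    intro i h
    simp only [Matrix.mulVec, dotProduct, cramerMat, Matrix.of_apply, h, dif_pos, sub_mul,
      Finset.sum_sub_distrib]
    rfl
  have row2 : ∀ (i : Fin n) (_ : ¬ (i : ℕ) + 1 < n), (cramerMat A *ᵥ y) i = ∑ i, y i := by
    intro i h
    simp only [Matrix.mulVec, dotProduct, cramerMat, Matrix.of_apply, h, dif_neg,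
      not_false_iff, one_mul]
  constructor
  · intro h
    refine ⟨fun i => ?_, ?_⟩
    · rcases Nat.eq_zero_or_pos (i : ℕ) with h0 | h0
      · congr 1; exact Fin.ext (by simpa using h0)
      · have hi : ((⟨(i : ℕ) - 1, by omega⟩ : Fin n) : ℕ) + 1 < n := by
          have := i.isLt; simp only; omega
        have := congrFun h ⟨(i : ℕ) - 1, by omega⟩
        rw [row1 _ hi, Pi.smul_apply, cramerVec, if_pos hi, smul_zero] at this
        have e : (⟨((⟨(i : ℕ) - 1, by omega⟩ : Fin n) : ℕ) + 1, hi⟩ : Fin n) = i :=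
          Fin.ext (by simp only; omega)
        rw [e] at this
        linarith
    · have hi : ¬ ((⟨n - 1, by omega⟩ : Fin n) : ℕ) + 1 < n := by simp only; omega
      have := congrFun h ⟨n - 1, by omega⟩
      rw [row2 _ hi, Pi.smul_apply, cramerVec, if_neg hi, smul_eq_mul, mul_one] at this
      exact this
  · rintro ⟨h1, h2⟩
    funext i
    by_cases hi : (i : ℕ) + 1 < n
    · rw [row1 i hi, h1 ⟨(i : ℕ) + 1, hi⟩, sub_self, Pi.smul_apply, cramerVec, if_pos hi, smul_zero]
    · rw [row2 i hi, h2, Pi.smul_apply, cramerVec, if_neg hi, smul_eq_mul, mul_one]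

/-- The solution of `M_A y = b` given by Cramer's rule. -/
noncomputable def cramerSol (A : Matrix (Fin n) (Fin n) ℝ) : Fin n → ℝ :=
  fun i => (cramerMatCol A i).det / (cramerMat A).det

lemma cramerMat_mulVec_cramerSol {A : Matrix (Fin n) (Fin n) ℝ} (h : (cramerMat A).det ≠ 0) :
    cramerMat A *ᵥ cramerSol A = cramerVec n := by
  have e : cramerSol A = ((cramerMat A).det)⁻¹ • Matrix.cramer (cramerMat A) (cramerVec n) := by
    funext i
    rw [Pi.smul_apply, Matrix.cramer_apply, smul_eq_mul, cramerSol, cramerMatCol, div_eq_inv_mul]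
  rw [e, Matrix.mulVec_smul, Matrix.mulVec_cramer, smul_smul, inv_mul_cancel₀ h, one_smul]

lemma eq_of_cramerMat_mulVec_eq {A : Matrix (Fin n) (Fin n) ℝ} (h : (cramerMat A).det ≠ 0)
    {y y' : Fin n → ℝ} (hy : cramerMat A *ᵥ y = cramerMat A *ᵥ y') : y = y' :=
  Matrix.mulVec_injective_of_isUnit ((Matrix.isUnit_iff_isUnit_det _).2 (isUnit_iff_ne_zero.2 h)) hy

/-- Positive Cramer solutions equalise all payoffs and so form an equilibrium. Because it has full
support, any other equilibrium also equalises and solves the same nonsingular systems. -/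
lemma isUniqueFullNash_cramerSol [NeZero n] {A : Matrix (Fin n) (Fin n) ℝ}
    (hr : (cramerMat Aᵀ).det ≠ 0) (hc : (cramerMat A).det ≠ 0)
    (hx : ∀ i, 0 < cramerSol Aᵀ i) (hy : ∀ i, 0 < cramerSol A i) :
    IsUniqueFullNash A (cramerSol Aᵀ) (cramerSol A) := by
  obtain ⟨ex, sx⟩ := cramerMat_mulVec_eq_iff (c := 1).1
    (by rw [one_smul]; exact cramerMat_mulVec_cramerSol hr)
  obtain ⟨ey, sy⟩ := cramerMat_mulVec_eq_iff (c := 1).1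
    (by rw [one_smul]; exact cramerMat_mulVec_cramerSol hc)
  rw [Matrix.mulVec_transpose] at ex
  have hN : IsNash A (cramerSol Aᵀ) (cramerSol A) :=
    isNash_of_equalizing ⟨fun i => (hx i).le, sx⟩ ⟨fun i => (hy i).le, sy⟩ ey ex
  refine ⟨hN, fun x' y' h' => ⟨?_, ?_⟩, hx, hy⟩
  · refine eq_of_cramerMat_mulVec_eq hr ?_
    rw [cramerMat_mulVec_cramerSol hr, ← one_smul ℝ (cramerVec n), cramerMat_mulVec_eq_iff,
      Matrix.mulVec_transpose]
    exact ⟨fun i => by rw [hN.vecMul_eq_of_full hy h', hN.vecMul_eq_of_full hy h'], h'.1.2⟩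
  · refine eq_of_cramerMat_mulVec_eq hc ?_
    rw [cramerMat_mulVec_cramerSol hc, ← one_smul ℝ (cramerVec n), cramerMat_mulVec_eq_iff]
    exact ⟨fun i => by rw [hN.mulVec_eq_of_full hx h', hN.mulVec_eq_of_full hx h'], h'.2.1.2⟩

lemma exists_pos_add_smul_pos {x : Fin n → ℝ} (hx : ∀ i, 0 < x i) (z : Fin n → ℝ) :
    ∃ c : ℝ, 0 < c ∧ ∀ i, 0 < x i + c * z i := by
  have h : ∀ i, ∀ᶠ c : ℝ in nhdsWithin 0 (Set.Ioi 0), 0 < x i + c * z i := by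
    intro i
    refine Filter.Eventually.filter_mono nhdsWithin_le_nhds ?_
    have : ContinuousAt (fun c : ℝ => x i + c * z i) 0 := by fun_prop
    exact this.eventually (lt_mem_nhds (by simpa using hx i))
  have h' := (Filter.eventually_all.2 h).and self_mem_nhdsWithin
  obtain ⟨c, hc, hc0⟩ := h'.exists
  exact ⟨c, hc0, hc⟩

namespace IsUniqueFullNash

variable {A : Matrix (Fin n) (Fin n) ℝ} {x y : Fin n → ℝ}

lemma neZero (h : IsUniqueFullNash A x y) : NeZero n := by
  refine ⟨?_⟩
  rintro rfl
  simpa using h.1.1.2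

lemma cramerMat_mulVec_right [NeZero n] (h : IsUniqueFullNash A x y) :
    cramerMat A *ᵥ y = cramerVec n := by
  rw [← one_smul ℝ (cramerVec n), cramerMat_mulVec_eq_iff]
  exact ⟨fun i => by
    rw [h.1.mulVec_eq_of_full h.2.2.1 h.1, h.1.mulVec_eq_of_full h.2.2.1 h.1], h.1.2.1.2⟩

lemma cramerMat_mulVec_left [NeZero n] (h : IsUniqueFullNash A x y) :
    cramerMat Aᵀ *ᵥ x = cramerVec n := by
  rw [← one_smul ℝ (cramerVec n), cramerMat_mulVec_eq_iff, Matrix.mulVec_transpose]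
  exact ⟨fun i => by
    rw [h.1.vecMul_eq_of_full h.2.2.2 h.1, h.1.vecMul_eq_of_full h.2.2.2 h.1], h.1.1.2⟩

/-- A kernel vector z would leave the payoffs equalised and the total mass unchanged, so y + c z
would be a second equilibrium strategy for small c > 0. -/
lemma det_right_ne_zero [NeZero n] (h : IsUniqueFullNash A x y) : (cramerMat A).det ≠ 0 := by
  intro h0
  obtain ⟨z, hz, hMz⟩ := Matrix.exists_mulVec_eq_zero_iff.2 h0
  obtain ⟨c, hc, hpos⟩ := exists_pos_add_smul_pos h.2.2.2 z
  have e : cramerMat A *ᵥ (y + c • z) = (1 : ℝ) • cramerVec n := by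
    rw [Matrix.mulVec_add, Matrix.mulVec_smul, hMz, smul_zero, add_zero, one_smul,
      h.cramerMat_mulVec_right]
  obtain ⟨e1, e2⟩ := cramerMat_mulVec_eq_iff.1 e
  have hN : IsNash A x (y + c • z) := isNash_of_equalizing h.1.1
    ⟨fun i => (hpos i).le, e2⟩ e1 (h.1.vecMul_eq_of_full h.2.2.2 h.1)
  have := (h.2.1 _ _ hN).2
  rw [add_eq_left, smul_eq_zero] at this
  exact this.elim hc.ne' hz

lemma det_left_ne_zero [NeZero n] (h : IsUniqueFullNash A x y) : (cramerMat Aᵀ).det ≠ 0 := by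
  intro h0
  obtain ⟨z, hz, hMz⟩ := Matrix.exists_mulVec_eq_zero_iff.2 h0
  obtain ⟨c, hc, hpos⟩ := exists_pos_add_smul_pos h.2.2.1 z
  have e : cramerMat Aᵀ *ᵥ (x + c • z) = (1 : ℝ) • cramerVec n := by
    rw [Matrix.mulVec_add, Matrix.mulVec_smul, hMz, smul_zero, add_zero, one_smul,
      h.cramerMat_mulVec_left]
  obtain ⟨e1, e2⟩ := cramerMat_mulVec_eq_iff.1 e
  rw [Matrix.mulVec_transpose] at e1
  have hN : IsNash A (x + c • z) y := isNash_of_equalizing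
    ⟨fun i => (hpos i).le, e2⟩ h.1.2.1 (h.1.mulVec_eq_of_full h.2.2.1 h.1) e1
  have := (h.2.1 _ _ hN).1
  rw [add_eq_left, smul_eq_zero] at this
  exact this.elim hc.ne' hz

lemma eq_cramerSol_left [NeZero n] (h : IsUniqueFullNash A x y) : x = cramerSol Aᵀ :=
  eq_of_cramerMat_mulVec_eq h.det_left_ne_zero
    (by rw [h.cramerMat_mulVec_left, cramerMat_mulVec_cramerSol h.det_left_ne_zero])

lemma eq_cramerSol_right [NeZero n] (h : IsUniqueFullNash A x y) : y = cramerSol A :=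
  eq_of_cramerMat_mulVec_eq h.det_right_ne_zero
    (by rw [h.cramerMat_mulVec_right, cramerMat_mulVec_cramerSol h.det_right_ne_zero])

lemma abs_detCol_le_left [NeZero n] (h : IsUniqueFullNash A x y) (i : Fin n) :
    |(cramerMatCol Aᵀ i).det| ≤ |(cramerMat Aᵀ).det| := by
  have h1 : x i ≤ 1 := (mem_Icc_of_mem_stdSimplex h.1.1 i).2
  have h0 := h.2.2.1 i
  rw [h.eq_cramerSol_left, cramerSol] at h1 h0
  rw [← abs_of_pos h0, abs_div] at h1
  exact (div_le_one (abs_pos.2 h.det_left_ne_zero)).1 h1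

lemma abs_detCol_le_right [NeZero n] (h : IsUniqueFullNash A x y) (i : Fin n) :
    |(cramerMatCol A i).det| ≤ |(cramerMat A).det| := by
  have h1 : y i ≤ 1 := (mem_Icc_of_mem_stdSimplex h.1.2.1 i).2
  have h0 := h.2.2.2 i
  rw [h.eq_cramerSol_right, cramerSol] at h1 h0
  rw [← abs_of_pos h0, abs_div] at h1
  exact (div_le_one (abs_pos.2 h.det_right_ne_zero)).1 h1

/-- The coordinates of the equilibrium are Cramer quotients bounded by 1, so the numerators never
exceed the denominators. This is why the bound needs only Δ_min although the algorithm tests Δ̃_min.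
-/
lemma deltaMin_le_deltaMinTilde [NeZero n] (h : IsUniqueFullNash A x y) :
    deltaMin A ≤ deltaMinTilde A := by
  obtain ⟨h1, h2⟩ := le_deltaMin_iff.1 (le_refl (deltaMin A))
  exact le_deltaMinTilde_iff.2 ⟨(h1 0).trans (h.abs_detCol_le_left 0),
    (h2 0).trans (h.abs_detCol_le_right 0), h1, h2⟩

lemma deltaMin_pos [NeZero n] (h : IsUniqueFullNash A x y) : 0 < deltaMin A := by
  have h1 : ∀ i, 0 < |(cramerMatCol Aᵀ i).det| := fun i => abs_pos.2 fun h0 => by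
    have := h.2.2.1 i
    rw [h.eq_cramerSol_left, cramerSol, h0, zero_div] at this
    exact this.false
  have h2 : ∀ i, 0 < |(cramerMatCol A i).det| := fun i => abs_pos.2 fun h0 => by
    have := h.2.2.2 i
    rw [h.eq_cramerSol_right, cramerSol, h0, zero_div] at this
    exact this.false
  rw [deltaMin, lt_min_iff]
  refine ⟨?_, ?_⟩
  · obtain ⟨i, hi⟩ := exists_eq_ciInf_of_finite (f := fun i => |(cramerMatCol Aᵀ i).det|)
    rw [← hi]; exact h1 i
  · obtain ⟨i, hi⟩ := exists_eq_ciInf_of_finite (f := fun i => |(cramerMatCol A i).det|)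
    rw [← hi]; exact h2 i

lemma vecMul_eq (h : IsUniqueFullNash A x y) (j : Fin n) : (x ᵥ* A) j = x ⬝ᵥ (A *ᵥ y) :=
  h.1.vecMul_eq_of_full h.2.2.2 h.1 j

end IsUniqueFullNash

/-- This description by signs of determinants serves twice: it is stable under perturbation, and it
makes the branching condition of the algorithm a measurable event. -/
lemma hasUniqueFullNash_iff [NeZero n] {A : Matrix (Fin n) (Fin n) ℝ} :
    HasUniqueFullNash A ↔ (cramerMat Aᵀ).det ≠ 0 ∧ (cramerMat A).det ≠ 0 ∧
      (∀ i, 0 < cramerSol Aᵀ i) ∧ ∀ i, 0 < cramerSol A i := by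
  constructor
  · rintro ⟨x, y, h⟩
    refine ⟨h.det_left_ne_zero, h.det_right_ne_zero, ?_, ?_⟩
    · rw [← h.eq_cramerSol_left]; exact h.2.2.1
    · rw [← h.eq_cramerSol_right]; exact h.2.2.2
  · rintro ⟨h1, h2, h3, h4⟩
    exact ⟨_, _, isUniqueFullNash_cramerSol h1 h2 h3 h4⟩

lemma div_pos_of_abs_sub_lt {a b a' b' c : ℝ} (h : 0 < a / b) (ha : c < |a|) (hb : c < |b|)
    (ha' : |a' - a| ≤ c) (hb' : |b' - b| ≤ c) : 0 < a' / b' := by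
  have key : ∀ {p q : ℝ}, c < |p| → |q - p| ≤ c → (0 < p → 0 < q) ∧ (p < 0 → q < 0) := by
    intro p q hp hq
    rw [abs_le] at hq
    refine ⟨fun h => ?_, fun h => ?_⟩
    · rw [abs_of_pos h] at hp; linarith
    · rw [abs_of_neg h] at hp; linarith
  rcases div_pos_iff.1 h with ⟨h1, h2⟩ | ⟨h1, h2⟩
  · exact div_pos ((key ha ha').1 h1) ((key hb hb').1 h2)
  · exact div_pos_of_neg_of_neg ((key ha ha').2 h1) ((key hb hb').2 h2)

/-- A sufficiently small perturbation of a game with a unique equilibrium, of full support, is again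
such a game. -/
lemma Close.hasUniqueFullNash [NeZero n] {A A' : Matrix (Fin n) (Fin n) ℝ} {e : ℝ}
    (h : Close A A' e) (hA : HasUniqueFullNash A) (he : 2 * n * n.factorial * e < deltaMinTilde A) :
    HasUniqueFullNash A' := by
  obtain ⟨h1, h2, h3, h4⟩ := le_deltaMinTilde_iff.1 (le_refl (deltaMinTilde A))
  obtain ⟨p1, p2, p3, p4⟩ := hasUniqueFullNash_iff.1 hA
  have hne : ∀ {a b : ℝ}, deltaMinTilde A ≤ |a| → |b - a| ≤ 2 * n * n.factorial * e → b ≠ 0 := by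
    rintro a b ha hb rfl
    rw [zero_sub, abs_neg] at hb
    linarith
  exact hasUniqueFullNash_iff.2 ⟨hne h1 h.transpose.abs_det_sub_le, hne h2 h.abs_det_sub_le,
    fun i => div_pos_of_abs_sub_lt (p3 i) (he.trans_le (h3 i)) (he.trans_le h1)
      (h.transpose.abs_detCol_sub_le i) h.transpose.abs_det_sub_le,
    fun i => div_pos_of_abs_sub_lt (p4 i) (he.trans_le (h4 i)) (he.trans_le h2)
      (h.abs_detCol_sub_le i) h.abs_det_sub_le⟩

/-! ### Confidence widths and the stopping test -/

lemma confWidth_eq (n T t : ℕ) :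
    confWidth n T t = 2 * √(Real.log (n * T)) / √t := by
  rw [confWidth, Real.sqrt_div' _ (Nat.cast_nonneg t), ← mul_pow, Real.log_pow,
    show 2 * (((2 : ℕ) : ℝ) * Real.log (n * T)) = 2 ^ 2 * Real.log (n * T) by push_cast; ring,
    Real.sqrt_mul (by norm_num), Real.sqrt_sq (by norm_num)]

lemma log_two_le_log {n T : ℕ} (hn : 2 ≤ n) (hT : 1 ≤ T) :
    Real.log 2 ≤ Real.log ((n : ℝ) * T) := by
  have h1 : (2 : ℝ) ≤ n := by exact_mod_cast hn
  have h2 : (1 : ℝ) ≤ T := by exact_mod_cast hT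
  exact Real.log_le_log (by norm_num) (by nlinarith)

lemma log_pos_of_two_le {n T : ℕ} (hn : 2 ≤ n) (hT : 1 ≤ T) : 0 < Real.log ((n : ℝ) * T) :=
  (Real.log_pos (by norm_num)).trans_le (log_two_le_log hn hT)

lemma confWidth_pos {n T t : ℕ} (hn : 2 ≤ n) (hT : 1 ≤ T) (ht : 1 ≤ t) : 0 < confWidth n T t := by
  have := log_pos_of_two_le hn hT
  have h' : (0 : ℝ) < t := by exact_mod_cast ht
  rw [confWidth_eq]
  positivity

lemma mul_confWidth_sq {n T t : ℕ} (hn : 2 ≤ n) (hT : 1 ≤ T) (ht : 1 ≤ t) :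
    (t : ℝ) * confWidth n T t ^ 2 = 4 * Real.log (n * T) := by
  have h' : (0 : ℝ) < t := by exact_mod_cast ht
  rw [confWidth_eq, div_pow, mul_pow, Real.sq_sqrt (log_pos_of_two_le hn hT).le,
    Real.sq_sqrt h'.le]
  field_simp
  ring

lemma confWidth_anti {n T s t : ℕ} (hs : 1 ≤ s) (hst : s ≤ t) :
    confWidth n T t ≤ confWidth n T s := by
  have h' : (0 : ℝ) < s := by exact_mod_cast hs
  have h2 : (s : ℝ) ≤ t := by exact_mod_cast hst
  rw [confWidth_eq, confWidth_eq]
  gcongr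

/-- The factor 6.25 = (5/2)² in the definition of t_* shrinks the width by 5/2. -/
lemma confWidth_le_of_mul_le {n T s t : ℕ} (hs : 1 ≤ s) (hst : (25 / 4 : ℝ) * s ≤ t) :
    5 / 2 * confWidth n T t ≤ confWidth n T s := by
  have h' : (0 : ℝ) < s := by exact_mod_cast hs
  have h2 : 5 / 2 * √(s : ℝ) ≤ √t := by
    rw [show (5 / 2 : ℝ) = √(25 / 4) by
      rw [show (25 / 4 : ℝ) = (5 / 2) ^ 2 by norm_num, Real.sqrt_sq (by norm_num)],
      ← Real.sqrt_mul (by norm_num)]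
    exact Real.sqrt_le_sqrt hst
  have h3 : 0 < √(s : ℝ) := Real.sqrt_pos.2 h'
  rw [confWidth_eq, confWidth_eq, ← mul_div_assoc, div_le_div_iff₀ (by linarith) h3]
  nlinarith [Real.sqrt_nonneg (Real.log (n * T))]

/-- For positive w, the upper bound 3/2 amounts to D ≥ 5w once D > w is known, and the lower bound 1
serves to exclude D ≤ w. -/
lemma stopTest_iff {T t : ℕ} {M : Matrix (Fin n) (Fin n) ℝ} (hn : 1 ≤ n)
    (hw : 0 < confWidth n T t) :
    StopTest T t M ↔ 10 * (n : ℝ) ^ 2 * n.factorial * confWidth n T t ≤ deltaMinTilde M := by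
  have hn' : (0 : ℝ) < n := by exact_mod_cast hn
  have hf : (0 : ℝ) < n.factorial := by exact_mod_cast n.factorial_pos
  have hw' : 0 < 2 * (n : ℝ) ^ 2 * n.factorial * confWidth n T t := by positivity
  rw [StopTest, show 10 * (n : ℝ) ^ 2 * n.factorial * confWidth n T t =
    5 * (2 * (n : ℝ) ^ 2 * n.factorial * confWidth n T t) by ring]
  generalize 2 * (n : ℝ) ^ 2 * n.factorial * confWidth n T t = w at *
  generalize deltaMinTilde M = D
  constructor
  · rintro ⟨h1, h2⟩
    have hb : 0 < D - w := by
      by_contra hb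
      rcases (not_lt.1 hb).lt_or_eq with hb | hb
      · rw [one_le_div_of_neg hb] at h1; linarith
      -- For D = w the quotient is 0 by the convention on division by zero, so the lower bound 1
      -- still fails.
      · rw [hb, div_zero] at h1; linarith
    rw [div_le_iff₀ hb] at h2
    linarith
  · intro h
    have hb : 0 < D - w := by linarith
    exact ⟨(one_le_div hb).2 (by linarith), (div_le_iff₀ hb).2 (by linarith)⟩

/-! ### Regret of an empirical equilibrium -/

lemma abs_dotProduct_le {x w : Fin n → ℝ} {e : ℝ} (hx : x ∈ stdSimplex ℝ (Fin n))
    (hw : ∀ i, |w i| ≤ e) : |x ⬝ᵥ w| ≤ e := by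
  calc |x ⬝ᵥ w| ≤ ∑ i, |x i * w i| := Finset.abs_sum_le_sum_abs _ _
    _ ≤ ∑ i, x i * e := Finset.sum_le_sum fun i _ => by
        rw [abs_mul, abs_of_nonneg (hx.1 i)]
        exact mul_le_mul_of_nonneg_left (hw i) (hx.1 i)
    _ = e := by rw [← Finset.sum_mul, hx.2, one_mul]

lemma Close.abs_vecMul_sub_le {A A' : Matrix (Fin n) (Fin n) ℝ} {e : ℝ} (h : Close A A' e)
    {x : Fin n → ℝ} (hx : x ∈ stdSimplex ℝ (Fin n)) (j : Fin n) :
    |(x ᵥ* A') j - (x ᵥ* A) j| ≤ e := by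
  have : (x ᵥ* A') j - (x ᵥ* A) j = x ⬝ᵥ fun i => A' i j - A i j := by
    simp only [Matrix.vecMul, dotProduct, mul_sub, Finset.sum_sub_distrib]
  rw [this]
  exact abs_dotProduct_le hx fun i => h.abs_sub_le i j

/-- Chain: x' against column j in `A` loses at most e compared with `A'`; there it gets at least the
value of `A'`, which is at least the payoff of x against y' in `A'`; returning to `A` loses another
e, and x guarantees the value of `A`. Neither uniqueness nor full support is needed. -/
lemma Close.value_sub_le_vecMul {A A' : Matrix (Fin n) (Fin n) ℝ} {e : ℝ} (h : Close A A' e)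
    {x y x' y' : Fin n → ℝ} (hN : IsNash A x y) (hN' : IsNash A' x' y') (j : Fin n) :
    x ⬝ᵥ (A *ᵥ y) - (x' ᵥ* A) j ≤ 2 * e := by
  have h1 := (abs_le.1 (h.abs_vecMul_sub_le hN'.1 j)).2
  have h2 := hN'.le_vecMul j
  have h3 := hN'.2.2.1 x hN.1
  have h4 : |y' ⬝ᵥ fun k => (x ᵥ* A') k - (x ᵥ* A) k| ≤ e :=
    abs_dotProduct_le hN'.2.1 fun k => h.abs_vecMul_sub_le hN.1 k
  have h5 : (y' ⬝ᵥ fun k => (x ᵥ* A') k - (x ᵥ* A) k) = x ⬝ᵥ (A' *ᵥ y') - x ⬝ᵥ (A *ᵥ y') := by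
    rw [Matrix.dotProduct_mulVec, Matrix.dotProduct_mulVec, dotProduct_comm _ y',
      dotProduct_comm _ y', ← dotProduct_sub]
    rfl
  rw [h5] at h4
  have h6 := (abs_le.1 h4).1
  have h7 := hN.2.2.2 y' hN'.2.1
  linarith

lemma vecMul_mem_Icc {A : Matrix (Fin n) (Fin n) ℝ} (hA : ∀ i k, A i k ∈ Set.Icc (0 : ℝ) 1)
    {x : Fin n → ℝ} (hx : x ∈ stdSimplex ℝ (Fin n)) (j : Fin n) :
    (x ᵥ* A) j ∈ Set.Icc (0 : ℝ) 1 :=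
  ⟨by
    rw [Matrix.vecMul, dotProduct]
    exact Finset.sum_nonneg fun i _ => mul_nonneg (hx.1 i) (hA i j).1,
    (le_abs_self _).trans (abs_dotProduct_le hx fun i => by
      rw [abs_of_nonneg (hA i j).1]; exact (hA i j).2)⟩

lemma value_mem_Icc {A : Matrix (Fin n) (Fin n) ℝ} (hA : ∀ i k, A i k ∈ Set.Icc (0 : ℝ) 1)
    {x y : Fin n → ℝ} (hx : x ∈ stdSimplex ℝ (Fin n)) (hy : y ∈ stdSimplex ℝ (Fin n)) :
    x ⬝ᵥ (A *ᵥ y) ∈ Set.Icc (0 : ℝ) 1 := by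
  have h := fun j => vecMul_mem_Icc hA hx j
  rw [Matrix.dotProduct_mulVec, dotProduct_comm]
  exact ⟨Finset.sum_nonneg fun i _ => mul_nonneg (hy.1 i) (h i).1,
    (le_abs_self _).trans (abs_dotProduct_le hy fun i => by
      rw [abs_of_nonneg (h i).1]; exact (h i).2)⟩

/-! ### One call of the subroutine -/

/-- The index of the last row. -/
def lastIdx (n : ℕ) [NeZero n] : Fin n := ⟨n - 1, Nat.sub_one_lt (NeZero.ne n)⟩

/-- The indices of all rows but the last. -/
def initIdx (n : ℕ) : Finset (Fin n) := Finset.univ.filter fun k : Fin n => (k : ℕ) + 1 < n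

lemma card_initIdx_le : ((initIdx n).card : ℝ) ≤ n := by
  have := Finset.card_le_univ (initIdx n)
  rw [Fintype.card_fin] at this
  exact_mod_cast this

/-! ### Projected gradient ascent on the first n - 1 coordinates -/

namespace SubParams

/-- The last coordinate balances the others, so a payoff depends only on the differences to the last
row. These differences are the gradients used in the update. -/
lemma sum_fullDelta_mul [NeZero n] (δ w : Fin n → ℝ) :
    ∑ i, fullDelta δ i * w i = ∑ k ∈ initIdx n, δ k * (w k - w (lastIdx n)) := by
  have hn : 0 < n := Nat.pos_of_ne_zero (NeZero.ne n)
  rw [← Finset.sum_filter_add_sum_filter_not Finset.univ (fun k : Fin n => (k : ℕ) + 1 < n)]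
  have h1 : (Finset.univ.filter fun k : Fin n => ¬ (k : ℕ) + 1 < n) = {lastIdx n} := by
    ext k
    simp only [Finset.mem_filter, Finset.mem_univ, true_and, Finset.mem_singleton, lastIdx,
      Fin.ext_iff]
    have := k.isLt
    omega
  have h2 : ¬ ((lastIdx n : Fin n) : ℕ) + 1 < n := by simp only [lastIdx]; omega
  rw [h1, Finset.sum_singleton, fullDelta, if_neg h2]
  simp_rw [mul_sub, Finset.sum_sub_distrib, ← Finset.sum_mul]
  rw [neg_mul, ← sub_eq_add_neg]
  congr 1
  refine Finset.sum_congr rfl fun k hk => ?_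
  rw [fullDelta, if_pos (Finset.mem_filter.1 hk).2]

lemma sum_fullDelta [NeZero n] (δ : Fin n → ℝ) : ∑ i, fullDelta δ i = 0 := by
  have := sum_fullDelta_mul δ fun _ => 1
  simpa using this

lemma fullDelta_sub (a b : Fin n → ℝ) : fullDelta (a - b) = fullDelta a - fullDelta b := by
  funext i
  simp only [fullDelta, Pi.sub_apply]
  split_ifs
  · rfl
  · rw [Finset.sum_sub_distrib]; ring

lemma fullDelta_eq_self [NeZero n] {z : Fin n → ℝ} (hz : ∑ i, z i = 0) : fullDelta z = z := by
  have h : ∀ i : Fin n, (i : ℕ) + 1 < n → fullDelta z i = z i := fun i hi => by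
    rw [fullDelta, if_pos hi]
  funext i
  by_cases hi : (i : ℕ) + 1 < n
  · exact h i hi
  · have h1 := sum_fullDelta z
    rw [← hz, ← Finset.add_sum_erase _ _ (Finset.mem_univ i),
      ← Finset.add_sum_erase _ z (Finset.mem_univ i)] at h1
    rw [Finset.sum_congr rfl fun k hk => h k ?_] at h1
    · linarith
    · have h2 := Finset.ne_of_mem_erase hk
      have h3 := k.isLt
      have h4 := i.isLt
      rw [Ne, Fin.ext_iff] at h2
      omega

lemma abs_fullDelta_le {δ : Fin n → ℝ} {r : ℝ} (hr : 0 ≤ r) (hδ : ∀ i, |δ i| ≤ r) (i : Fin n) :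
    |fullDelta δ i| ≤ n * r := by
  have hn : (1 : ℝ) ≤ n := by exact_mod_cast (show 1 ≤ n from i.pos)
  rw [fullDelta]
  split_ifs
  · exact (hδ i).trans (by nlinarith)
  · rw [abs_neg]
    refine (Finset.abs_sum_le_sum_abs _ _).trans ?_
    refine (Finset.sum_le_card_nsmul _ _ r fun k _ => hδ k).trans ?_
    rw [nsmul_eq_mul]
    exact mul_le_mul_of_nonneg_right card_initIdx_le hr

lemma play_mem {p : SubParams n} (hp : p.x' ∈ stdSimplex ℝ (Fin n)) (δ : Fin n → ℝ) :
    p.play δ ∈ stdSimplex ℝ (Fin n) := by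
  rw [play]
  split_ifs with h
  · exact h
  · exact hp

lemma abs_update_le {p : SubParams n} (hr : 0 ≤ p.radius) (δ : Fin n → ℝ) (j i : Fin n) :
    |p.update δ j i| ≤ p.radius := by
  rw [update, abs_le]
  exact ⟨le_max_left _ _, max_le (by linarith) (min_le_left _ _)⟩

/-- The potential of online gradient descent with comparator `δs`. -/
noncomputable def potential (p : SubParams n) (δs δ : Fin n → ℝ) : ℝ :=
  ∑ k ∈ initIdx n, (δ k - δs k) ^ 2 / (2 * p.eta)

lemma potential_nonneg {p : SubParams n} (he : 0 ≤ p.eta) (δs δ : Fin n → ℝ) :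
    0 ≤ p.potential δs δ :=
  Finset.sum_nonneg fun _ _ => by positivity

lemma potential_init_le {p : SubParams n} (he : 0 < p.eta) {δs : Fin n → ℝ}
    (hδs : ∀ i, |δs i| ≤ p.radius) : p.potential δs p.init ≤ n * (2 * p.radius ^ 2 / p.eta) := by
  rw [potential]
  refine (Finset.sum_le_card_nsmul _ _ (2 * p.radius ^ 2 / p.eta) fun k _ => ?_).trans ?_
  · have := abs_le.1 (hδs k)
    rw [init, div_le_div_iff₀ (by positivity) he]
    have h2 : (-p.radius - δs k) ^ 2 ≤ (2 * p.radius) ^ 2 := by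
      apply sq_le_sq'  <;> linarith
    nlinarith
  · rw [nsmul_eq_mul]
    exact mul_le_mul_of_nonneg_right card_initIdx_le (by positivity)

lemma sq_clip_sub_le {r a b : ℝ} (hb : |b| ≤ r) :
    (max (-r) (min r a) - b) ^ 2 ≤ (a - b) ^ 2 := by
  obtain ⟨h1, h2⟩ := abs_le.1 hb
  rcases le_total r a with h | h
  · rw [min_eq_left h, max_eq_right (by linarith)]
    apply sq_le_sq' <;> linarith
  · rw [min_eq_right h]
    rcases le_total (-r) a with h' | h'
    · rw [max_eq_right h']
    · rw [max_eq_left h']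
      have : (b - -r) ^ 2 ≤ (b - a) ^ 2 := by apply sq_le_sq' <;> linarith
      nlinarith

/-- Expand (a + ηg - b)². Clipping to the box only brings the point closer to b, which lies in the
box, and the quadratic term is at most η²; division by 2η leaves η/2. -/
lemma gradient_step_le {r a b g η : ℝ} (hη : 0 < η) (hb : |b| ≤ r) (hg : |g| ≤ 1) :
    (b - a) * g ≤
      (a - b) ^ 2 / (2 * η) - (max (-r) (min r (a + η * g)) - b) ^ 2 / (2 * η) + η / 2 := by
  have h1 := sq_clip_sub_le (a := a + η * g) hb
  have h2 : g ^ 2 ≤ 1 := (sq_le_one_iff_abs_le_one g).2 hg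
  rw [← sub_div, ← sub_le_iff_le_add, le_div_iff₀ (by positivity)]
  nlinarith [mul_le_mul_of_nonneg_left h2 (sq_nonneg η)]

end SubParams

/-- The bound on the regret of one call of the subroutine. -/
noncomputable def callBound (T : ℕ) (A : Matrix (Fin n) (Fin n) ℝ) : ℝ :=
  210 * (n : ℝ) ^ 2 * n.factorial * Real.log (n * T) / |cramerD A|

section Call

variable {A A' : Matrix (Fin n) (Fin n) ℝ} {xs ys : Fin n → ℝ} {T t : ℕ}
  {nash : Matrix (Fin n) (Fin n) ℝ → (Fin n → ℝ) × (Fin n → ℝ)}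

/-- The empirical matrix `A'` after `t` rounds is accurate enough for a call of the subroutine. -/
structure Accurate (nash : Matrix (Fin n) (Fin n) ℝ → (Fin n → ℝ) × (Fin n → ℝ)) (T t : ℕ)
    (A A' : Matrix (Fin n) (Fin n) ℝ) (xs ys : Fin n → ℝ) : Prop where
  two_le : 2 ≤ n
  one_le_horizon : 1 ≤ T
  one_le_time : 1 ≤ t
  isNash : ∀ M, IsNash M (nash M).1 (nash M).2
  unique : IsUniqueFullNash A xs ys
  close : Close A A' (confWidth n T t)
  le_deltaMinTilde : 20 * (n : ℝ) ^ 2 * n.factorial * confWidth n T t ≤ deltaMinTilde A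

namespace Accurate

lemma confWidth_pos (h : Accurate nash T t A A' xs ys) : 0 < confWidth n T t :=
  MatrixGame.confWidth_pos h.two_le h.one_le_horizon h.one_le_time

lemma error_le (h : Accurate nash T t A A' xs ys) :
    2 * (n : ℝ) * n.factorial * confWidth n T t ≤
      2 * (n : ℝ) ^ 2 * n.factorial * confWidth n T t := by
  have h1 : (1 : ℝ) ≤ n := by exact_mod_cast (show 1 ≤ n by linarith [h.two_le])
  have := h.confWidth_pos
  gcongr
  nlinarith

lemma width_pos (h : Accurate nash T t A A' xs ys) :
    0 < (n : ℝ) ^ 2 * n.factorial * confWidth n T t := by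
  have h1 : (0 : ℝ) < n := by exact_mod_cast (show 0 < n by linarith [h.two_le])
  have h2 : (0 : ℝ) < n.factorial := by exact_mod_cast n.factorial_pos
  have := h.confWidth_pos
  positivity

variable [NeZero n]

lemma uniqueFullNash (h : Accurate nash T t A A' xs ys) :
    IsUniqueFullNash A' (nash A').1 (nash A').2 := by
  have h1 : HasUniqueFullNash A' := h.close.hasUniqueFullNash ⟨_, _, h.unique⟩ (by
    have := h.le_deltaMinTilde
    have := h.error_le
    have := h.width_pos
    linarith)
  obtain ⟨x, y, hxy⟩ := h1
  obtain ⟨e1, e2⟩ := hxy.2.1 _ _ (h.isNash A')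
  rw [e1, e2]
  exact hxy

lemma le_deltaMinTilde_right (h : Accurate nash T t A A' xs ys) :
    18 * (n : ℝ) ^ 2 * n.factorial * confWidth n T t ≤ deltaMinTilde A' := by
  have := h.close.deltaMinTilde_le
  have := h.le_deltaMinTilde
  have := h.error_le
  linarith

lemma det_pos (h : Accurate nash T t A A' xs ys) : 0 < |(cramerMat A'ᵀ).det| := by
  have := (le_deltaMinTilde_iff.1 h.le_deltaMinTilde_right).1
  have := h.width_pos
  linarith

lemma D₁_pos (h : Accurate nash T t A A' xs ys) : 0 < (subCall nash T t A').D₁ := by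
  have h1 : (0 : ℝ) < n := by exact_mod_cast (show 0 < n by linarith [h.two_le])
  have h2 : (0 : ℝ) < n.factorial := by exact_mod_cast n.factorial_pos
  have := h.det_pos
  rw [subCall]
  positivity

lemma radius_eq (h : Accurate nash T t A A' xs ys) :
    (subCall nash T t A').radius = confWidth n T t / (subCall nash T t A').D₁ := by
  have := h.confWidth_pos
  have h1 : √(subCall nash T t A').T₁ = 1 / confWidth n T t := by
    rw [subCall]; exact Real.sqrt_sq (by positivity)
  have := h.D₁_pos
  rw [SubParams.radius, h1]
  field_simp

lemma eta_eq (h : Accurate nash T t A A' xs ys) :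
    (subCall nash T t A').eta = confWidth n T t ^ 2 / (subCall nash T t A').D₁ := by
  have := h.confWidth_pos
  have h1 : (subCall nash T t A').T₁ = (1 / confWidth n T t) ^ 2 := rfl
  have := h.D₁_pos
  rw [SubParams.eta, h1]
  field_simp

lemma radius_pos (h : Accurate nash T t A A' xs ys) : 0 < (subCall nash T t A').radius := by
  rw [h.radius_eq]; exact div_pos h.confWidth_pos h.D₁_pos

lemma eta_pos (h : Accurate nash T t A A' xs ys) : 0 < (subCall nash T t A').eta := by
  rw [h.eta_eq]; exact div_pos (pow_pos h.confWidth_pos 2) h.D₁_pos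

lemma det_mul_radius (h : Accurate nash T t A A' xs ys) :
    |(cramerMat A'ᵀ).det| * (subCall nash T t A').radius =
      5 * n * n.factorial * confWidth n T t := by
  have h1 : (0 : ℝ) < n := by exact_mod_cast (show 0 < n by linarith [h.two_le])
  have h2 : (0 : ℝ) < n.factorial := by exact_mod_cast n.factorial_pos
  have := h.det_pos
  rw [h.radius_eq, subCall]
  field_simp

/-- The radius is large enough to reach the true equilibrium strategy. -/
lemma abs_comparator_le (h : Accurate nash T t A A' xs ys) (i : Fin n) :
    |(xs - (nash A').1) i| ≤ (subCall nash T t A').radius := by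
  have hw := h.confWidth_pos
  have hb := abs_det_mul_abs_le (P := cramerMat A'ᵀ) (z := xs - (nash A').1)
    (e := 2 * confWidth n T t) (abs_cramerMat_le h.close.transpose.right_mem) (fun k => ?_) i
  · refine le_of_mul_le_mul_left ?_ h.det_pos
    rw [h.det_mul_radius]
    refine hb.trans ?_
    have : 0 ≤ (n : ℝ) * n.factorial * confWidth n T t := by positivity
    linarith
  -- Both strategies solve their own system with the same right-hand side, so M_{A'ᵀ}(x* - x') =
  -- (M_{A'ᵀ} - M_{Aᵀ}) x*, whose entries are at most 2 w_t.
  · rw [Matrix.mulVec_sub, h.uniqueFullNash.cramerMat_mulVec_left,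
      ← h.unique.cramerMat_mulVec_left, ← Matrix.sub_mulVec, Matrix.mulVec, dotProduct_comm]
    refine abs_dotProduct_le h.unique.1.1 fun l => ?_
    rw [Matrix.sub_apply]
    exact abs_cramerMat_sub_le hw.le h.close.transpose.abs_sub_le k l

/-- The fallback to x' never occurs: each coordinate moves by at most n r, and |det| · n r = 5 n² n!
w_t, while |det| · x'_i is a Cramer numerator of size at least 18 n² n! w_t. -/
lemma play_eq (h : Accurate nash T t A A' xs ys) {δ : Fin n → ℝ}
    (hδ : ∀ i, |δ i| ≤ (subCall nash T t A').radius) :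
    (subCall nash T t A').play δ = (nash A').1 + SubParams.fullDelta δ := by
  have hx : (subCall nash T t A').x' = (nash A').1 := rfl
  rw [SubParams.play, hx, if_pos]
  refine ⟨fun i => ?_, ?_⟩
  · have h1 := (abs_le.1 (SubParams.abs_fullDelta_le h.radius_pos.le hδ i)).1
    have h2 : (n : ℝ) * (subCall nash T t A').radius ≤ (nash A').1 i := by
      refine le_of_mul_le_mul_left ?_ h.det_pos
      rw [mul_left_comm, h.det_mul_radius, ← abs_of_pos (h.uniqueFullNash.2.2.1 i), ← abs_mul,
        h.uniqueFullNash.eq_cramerSol_left, cramerSol,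
        mul_div_cancel₀ _ h.uniqueFullNash.det_left_ne_zero]
      have := (le_deltaMinTilde_iff.1 h.le_deltaMinTilde_right).2.2.1 i
      have := h.width_pos
      nlinarith
    rw [Pi.add_apply]
    linarith
  · simp only [Pi.add_apply]
    rw [Finset.sum_add_distrib, SubParams.sum_fullDelta, h.uniqueFullNash.1.1.2, add_zero]

/-- Both xs and its empirical counterpart have total mass 1, so the regret is a sum over the first n
- 1 coordinates. In each, the gradient step is applied with the empirical gradient; replacing it by
the true one costs at most 2r · 2w_t. -/
lemma regret_step (h : Accurate nash T t A A' xs ys) {δ : Fin n → ℝ}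
    (hδ : ∀ i, |δ i| ≤ (subCall nash T t A').radius) (j : Fin n) :
    xs ⬝ᵥ (A *ᵥ ys) - ((subCall nash T t A').play δ ᵥ* A) j
        + (subCall nash T t A').potential (xs - (nash A').1) ((subCall nash T t A').update δ j)
      ≤ (subCall nash T t A').potential (xs - (nash A').1) δ
        + n * ((subCall nash T t A').eta / 2
            + 4 * (subCall nash T t A').radius * confWidth n T t) := by
  set p := subCall nash T t A' with hp
  set δs := xs - (nash A').1 with hδs
  have hsum : ∑ i, δs i = 0 := by
    simp only [hδs, Pi.sub_apply]
    rw [Finset.sum_sub_distrib, h.unique.1.1.2, h.uniqueFullNash.1.1.2, sub_self]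
  have e1 : xs ⬝ᵥ (A *ᵥ ys) - (p.play δ ᵥ* A) j =
      ∑ k ∈ initIdx n, (δs k - δ k) * (A k j - A (lastIdx n) j) := by
    have : xs - ((nash A').1 + SubParams.fullDelta δ) = SubParams.fullDelta (δs - δ) := by
      rw [SubParams.fullDelta_sub, SubParams.fullDelta_eq_self hsum, hδs, sub_add_eq_sub_sub]
    rw [← h.unique.vecMul_eq j, h.play_eq hδ, ← Pi.sub_apply, ← Matrix.sub_vecMul, this]
    exact SubParams.sum_fullDelta_mul (δs - δ) fun k => A k j
  rw [e1, SubParams.potential, SubParams.potential, ← Finset.sum_add_distrib]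
  have hr := h.radius_pos
  have hη := h.eta_pos
  have hw := h.confWidth_pos
  rw [← hp] at hr hη
  have key : ∀ k ∈ initIdx n, (δs k - δ k) * (A k j - A (lastIdx n) j)
      + (p.update δ j k - δs k) ^ 2 / (2 * p.eta) ≤ (δ k - δs k) ^ 2 / (2 * p.eta)
        + (p.eta / 2 + 4 * p.radius * confWidth n T t) := by
    intro k _
    have hk : |δs k| ≤ p.radius := h.abs_comparator_le k
    have a1 := h.close.right_mem k j
    have a2 := h.close.right_mem (lastIdx n) j
    have hg : |A' k j - A' (lastIdx n) j| ≤ 1 := by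
      rw [abs_le]; constructor <;> linarith [a1.1, a1.2, a2.1, a2.2]
    have hs := SubParams.gradient_step_le (a := δ k) hη hk hg
    have hu : p.update δ j k = max (-p.radius) (min p.radius
      (δ k + p.eta * (A' k j - A' (lastIdx n) j))) := rfl
    rw [← hu] at hs
    have b1 := abs_le.1 (h.close.abs_sub_le k j)
    have b2 := abs_le.1 (h.close.abs_sub_le (lastIdx n) j)
    have hd : |(δs k - δ k) * ((A k j - A (lastIdx n) j) - (A' k j - A' (lastIdx n) j))| ≤
        (2 * p.radius) * (2 * confWidth n T t) := by
      rw [abs_mul]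
      refine mul_le_mul ?_ ?_ (abs_nonneg _) (by positivity)
      · have c1 := abs_le.1 hk
        have c2 := abs_le.1 (hδ k)
        rw [abs_le]; constructor <;> linarith [c1.1, c1.2, c2.1, c2.2]
      · rw [abs_le]; constructor <;> linarith [b1.1, b1.2, b2.1, b2.2]
    have := (abs_le.1 hd).2
    linarith
  refine (Finset.sum_le_sum key).trans ?_
  rw [Finset.sum_add_distrib, Finset.sum_const, nsmul_eq_mul]
  exact add_le_add_right (mul_le_mul_of_nonneg_right card_initIdx_le (by positivity)) _

/-- The total budget of a call. -/
lemma budget_le (h : Accurate nash T t A A' xs ys) {m : ℕ} (hm : m ≤ t) :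
    n * (2 * (subCall nash T t A').radius ^ 2 / (subCall nash T t A').eta)
      + m * (n * ((subCall nash T t A').eta / 2
            + 4 * (subCall nash T t A').radius * confWidth n T t)) ≤ callBound T A := by
  have hD := h.D₁_pos
  have hw := h.confWidth_pos
  have h1 : (0 : ℝ) < n := by exact_mod_cast (show 0 < n by linarith [h.two_le])
  have h2 : (0 : ℝ) < n.factorial := by exact_mod_cast n.factorial_pos
  have hm' : (m : ℝ) ≤ t := by exact_mod_cast hm
  have hη := h.eta_pos
  have hr := h.radius_pos
  have hL := mul_confWidth_sq h.two_le h.one_le_horizon h.one_le_time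
  have hlog := log_two_le_log h.two_le h.one_le_horizon
  have hlog2 := Real.log_two_gt_d9
  have hdet : |cramerD A| / 2 ≤ |(cramerMat A'ᵀ).det| := by
    have e2 := (le_deltaMinTilde_iff.1 h.le_deltaMinTilde).1
    have e3 := h.error_le
    have e4 := h.width_pos
    have e5 := abs_sub_abs_le_abs_sub (cramerMat Aᵀ).det (cramerMat A'ᵀ).det
    rw [abs_sub_comm] at e5
    have e6 := h.close.transpose.abs_det_sub_le
    rw [cramerD]
    linarith
  have hDA : 0 < |cramerD A| := abs_pos.2 h.unique.det_left_ne_zero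
  calc _ ≤ n * (2 * (subCall nash T t A').radius ^ 2 / (subCall nash T t A').eta)
      + t * (n * ((subCall nash T t A').eta / 2
            + 4 * (subCall nash T t A').radius * confWidth n T t)) := by gcongr
    -- With r = w_t/D₁ and η = w_t²/D₁, the initial potential contributes 2, the steps 1/2 and the
    -- matrix error 4, in units of n/D₁ and n t w_t²/D₁.
    _ = n * (2 + 9 / 2 * (t * confWidth n T t ^ 2)) / (subCall nash T t A').D₁ := by
      rw [h.eta_eq, h.radius_eq]
      field_simp
      ring
    _ = n * (2 + 18 * Real.log (n * T)) * (5 * n * n.factorial) / |(cramerMat A'ᵀ).det| := by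
      have := h.det_pos
      rw [hL, subCall]
      field_simp
      ring
    _ ≤ n * (21 * Real.log (n * T)) * (5 * n * n.factorial) / (|cramerD A| / 2) := by
      have h3 : 0 < Real.log ((n : ℝ) * T) := by linarith
      -- Here 2 ≤ 3 log(nT) because n ≥ 2. The final constant is 210 = 21 · 5 · 2, the last factor
      -- coming from |D|/2 ≤ |det M_{A'ᵀ}|.
      have h4 : 2 + 18 * Real.log ((n : ℝ) * T) ≤ 21 * Real.log (n * T) := by linarith
      gcongr
    _ = callBound T A := by
      rw [callBound]
      field_simp
      ring

end Accurate

end Call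

/-! ### The regret on a path with accurate empirical means -/

/-- The mean of the first `t` matrices. -/
noncomputable def empMean (B : ℕ → Matrix (Fin n) (Fin n) ℝ) (t : ℕ) : Matrix (Fin n) (Fin n) ℝ :=
  (1 / (t : ℝ)) • ∑ s ∈ Finset.range t, B s

lemma empMean_apply (B : ℕ → Matrix (Fin n) (Fin n) ℝ) (t : ℕ) (i k : Fin n) :
    empMean B t i k = (∑ s ∈ Finset.range t, B s i k) / t := by
  rw [empMean, Matrix.smul_apply, Matrix.sum_apply, smul_eq_mul, one_div_mul_eq_div]

lemma empMean_mem {B : ℕ → Matrix (Fin n) (Fin n) ℝ} {t : ℕ}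
    (hB : ∀ s < t, ∀ i k, B s i k ∈ Set.Icc (0 : ℝ) 1) (i k : Fin n) :
    empMean B t i k ∈ Set.Icc (0 : ℝ) 1 := by
  rw [empMean_apply]
  have h0 : ∀ s ∈ Finset.range t, 0 ≤ B s i k := fun s hs => (hB s (Finset.mem_range.1 hs) i k).1
  have h1 : ∀ s ∈ Finset.range t, B s i k ≤ 1 := fun s hs => (hB s (Finset.mem_range.1 hs) i k).2
  refine ⟨div_nonneg (Finset.sum_nonneg h0) (Nat.cast_nonneg t),
    div_le_one_of_le₀ ((Finset.sum_le_sum h1).trans ?_) (Nat.cast_nonneg t)⟩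
  simp

section State

variable (nash : Matrix (Fin n) (Fin n) ℝ → (Fin n → ℝ) × (Fin n → ℝ)) (T : ℕ)

lemma AlgState.step_rounds_total (s : AlgState n) (B : Matrix (Fin n) (Fin n) ℝ) (j : Fin n) :
    (s.step nash T B j).rounds = s.rounds + 1 ∧ (s.step nash T B j).total = s.total + B := by
  cases h : s.phase <;> simp only [AlgState.step, h] <;> (try split_ifs) <;>
    exact ⟨by trivial, by trivial⟩

lemma algState_rounds_total (B : ℕ → Matrix (Fin n) (Fin n) ℝ) (j : ℕ → Fin n) (t : ℕ) :
    (algState nash T B j t).rounds = t ∧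
      (algState nash T B j t).total = ∑ s ∈ Finset.range t, B s := by
  induction t with
  | zero => exact ⟨rfl, by simp [algState, initState]⟩
  | succ t ih =>
    obtain ⟨h1, h2⟩ := AlgState.step_rounds_total nash T (algState nash T B j t) (B t) (j t)
    exact ⟨by rw [algState, h1, ih.1], by rw [algState, h2, ih.2, Finset.sum_range_succ]⟩

lemma algState_mean (B : ℕ → Matrix (Fin n) (Fin n) ℝ) (j : ℕ → Fin n) (t : ℕ) :
    (1 / (((algState nash T B j t).rounds + 1 : ℕ) : ℝ)) • ((algState nash T B j t).total + B t) =
      empMean B (t + 1) := by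
  obtain ⟨h1, h2⟩ := algState_rounds_total nash T B j t
  rw [h1, h2, empMean, Finset.sum_range_succ]

end State

/-- The matrices of a run have entries in `[0, 1]`, and all their empirical means up to the horizon
are as accurate as the confidence widths say. -/
structure GoodPath (nash : Matrix (Fin n) (Fin n) ℝ → (Fin n → ℝ) × (Fin n → ℝ)) (T : ℕ)
    (B : ℕ → Matrix (Fin n) (Fin n) ℝ) (A : Matrix (Fin n) (Fin n) ℝ) (xs ys : Fin n → ℝ) :
    Prop where
  two_le : 2 ≤ n
  one_le_horizon : 1 ≤ T
  isNash : ∀ M, IsNash M (nash M).1 (nash M).2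
  unique : IsUniqueFullNash A xs ys
  mem : ∀ i k, A i k ∈ Set.Icc (0 : ℝ) 1
  mem_path : ∀ t < T, ∀ i k, B t i k ∈ Set.Icc (0 : ℝ) 1
  accurate : ∀ t, 1 ≤ t → t ≤ T → ∀ i k, |empMean B t i k - A i k| ≤ confWidth n T t

/-- What is known about `t_*` after `t` rounds, where `P τ` says that the test of round `τ` was
positive. -/
structure TestInv (T t : ℕ) (P : ℕ → Prop) (u : ℝ) : Prop where
  origin : u = T + 1 ∨ ∃ τ, 1 ≤ τ ∧ τ ≤ t ∧ P τ ∧ u = (25 / 4 : ℝ) * τ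
  bound : ∀ τ, 1 ≤ τ → τ ≤ t → P τ → u ≤ (25 / 4 : ℝ) * τ ∨ (T : ℝ) < (25 / 4 : ℝ) * τ

/-- A value of t_* beyond the horizon is overwritten by a later positive test. An earlier positive
test may thus be forgotten, but then 25τ/4 > T, which is the second alternative of `bound`. If a
positive test does not overwrite, then t_* ≤ T already stems from an earlier test. -/
lemma TestInv.update {T t : ℕ} {B : ℕ → Matrix (Fin n) (Fin n) ℝ} {u : ℝ}
    (h : TestInv T t (fun τ => StopTest T τ (empMean B τ)) u) :
    TestInv T (t + 1) (fun τ => StopTest T τ (empMean B τ))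
      (tstarUpdate T (t + 1) (empMean B (t + 1)) u) := by
  rw [tstarUpdate]
  split_ifs with hc
  · refine ⟨Or.inr ⟨t + 1, by omega, le_rfl, hc.1, rfl⟩, fun τ h1 h2 h3 => ?_⟩
    rcases Nat.lt_or_ge t τ with h4 | h4
    · obtain rfl : τ = t + 1 := by omega
      exact Or.inl le_rfl
    · rcases h.bound τ h1 h4 h3 with h5 | h5
      · exact Or.inr (hc.2.trans_le h5)
      · exact Or.inr h5
  · refine ⟨h.origin.imp_right fun ⟨τ, h1, h2, h3⟩ => ⟨τ, h1, by omega, h3⟩, fun τ h1 h2 h3 => ?_⟩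
    rcases Nat.lt_or_ge t τ with h4 | h4
    · obtain rfl : τ = t + 1 := by omega
      have h5 : ¬ (T : ℝ) < u := fun h5 => hc ⟨h3, h5⟩
      rcases h.origin with h6 | ⟨τ, -, h7, -, h8⟩
      · rw [h6] at h5; linarith
      · have : (τ : ℝ) ≤ (t + 1 : ℕ) := by exact_mod_cast h2.trans' (by omega)
        left; rw [h8]; linarith
    · exact h.bound τ h1 h4 h3

/-- The bound on the regret of the exploration phase. -/
noncomputable def exploreBound (T : ℕ) (A : Matrix (Fin n) (Fin n) ℝ) : ℝ :=
  768 * ((n : ℝ) ^ 2 * n.factorial * Real.log (n * T) / deltaMin A)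

namespace GoodPath

variable {nash : Matrix (Fin n) (Fin n) ℝ → (Fin n → ℝ) × (Fin n → ℝ)} {T : ℕ}
  {B : ℕ → Matrix (Fin n) (Fin n) ℝ} {A : Matrix (Fin n) (Fin n) ℝ} {xs ys : Fin n → ℝ}

lemma close (h : GoodPath nash T B A xs ys) {t : ℕ} (h1 : 1 ≤ t) (h2 : t ≤ T) :
    Close A (empMean B t) (confWidth n T t) :=
  ⟨(confWidth_pos h.two_le h.one_le_horizon h1).le, h.mem,
    empMean_mem fun s hs => h.mem_path s (by omega), h.accurate t h1 h2⟩

lemma log_pos (h : GoodPath nash T B A xs ys) : 0 < Real.log ((n : ℝ) * T) :=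
  log_pos_of_two_le h.two_le h.one_le_horizon

lemma width_le (h : GoodPath nash T B A xs ys) {t : ℕ} (h1 : 1 ≤ t) :
    2 * (n : ℝ) * n.factorial * confWidth n T t ≤
      2 * (n : ℝ) ^ 2 * n.factorial * confWidth n T t := by
  have h2 : (1 : ℝ) ≤ n := by exact_mod_cast (show 1 ≤ n by linarith [h.two_le])
  have := confWidth_pos h.two_le h.one_le_horizon h1
  gcongr
  nlinarith

variable [NeZero n]

/-- A positive test gives 10 N w_τ for the empirical matrix with N = n² n!, hence 8 N w_τ for `A`;
waiting until 6.25 τ turns this into 8 · 5/2 = 20 times N w_t. -/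
lemma le_deltaMinTilde_of_stopTest (h : GoodPath nash T B A xs ys) {τ t : ℕ} (h1 : 1 ≤ τ)
    (h2 : (25 / 4 : ℝ) * τ ≤ t) (h3 : t ≤ T) (hs : StopTest T τ (empMean B τ)) :
    20 * (n : ℝ) ^ 2 * n.factorial * confWidth n T t ≤ deltaMinTilde A := by
  have hτ : τ ≤ T := by
    have : (t : ℝ) ≤ T := by exact_mod_cast h3
    have : (τ : ℝ) ≤ T := by linarith [(Nat.cast_nonneg τ : (0 : ℝ) ≤ τ)]
    exact_mod_cast this
  have e1 := (stopTest_iff (by linarith [h.two_le])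
    (confWidth_pos h.two_le h.one_le_horizon h1)).1 hs
  have e2 := (h.close h1 hτ).symm.deltaMinTilde_le
  have e3 := h.width_le h1
  have e4 := confWidth_le_of_mul_le (n := n) (T := T) h1 h2
  have e5 : 0 ≤ (n : ℝ) ^ 2 * n.factorial := by positivity
  nlinarith [mul_le_mul_of_nonneg_left e4 e5]

lemma deltaMin_le_of_not_stopTest (h : GoodPath nash T B A xs ys) {τ : ℕ} (h1 : 1 ≤ τ)
    (h2 : τ ≤ T) (hs : ¬ StopTest T τ (empMean B τ)) :
    deltaMin A ≤ 12 * (n : ℝ) ^ 2 * n.factorial * confWidth n T τ := by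
  rw [stopTest_iff (by linarith [h.two_le]) (confWidth_pos h.two_le h.one_le_horizon h1),
    not_le] at hs
  have e2 := (h.close h1 h2).deltaMinTilde_le
  have e3 := h.width_le h1
  have e4 := h.unique.deltaMin_le_deltaMinTilde
  linarith

lemma one_le_scaled (h : GoodPath nash T B A xs ys) :
    1 ≤ n.factorial / deltaMin A :=
  (one_le_div h.unique.deltaMin_pos).2 (deltaMin_le_factorial h.mem)

lemma explore_le (h : GoodPath nash T B A xs ys) {t : ℕ} (ht : t ≤ T)
    (hs : ∀ τ, 1 ≤ τ → τ ≤ t → StopTest T τ (empMean B τ) → (t : ℝ) < (25 / 4 : ℝ) * τ) :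
    8 * √(Real.log (n * T)) * √t ≤ exploreBound T A := by
  have hL := h.log_pos
  set w := √(Real.log ((n : ℝ) * T)) with hw
  have hw2 : w ^ 2 = Real.log ((n : ℝ) * T) := Real.sq_sqrt hL.le
  have hw0 : 0 < w := Real.sqrt_pos.2 hL
  have hd := h.unique.deltaMin_pos
  have hn : (2 : ℝ) ≤ n := by exact_mod_cast h.two_le
  have hf : (0 : ℝ) < n.factorial := by exact_mod_cast n.factorial_pos
  suffices hmain : √(t : ℝ) ≤ 96 * (n : ℝ) ^ 2 * n.factorial * w / deltaMin A by
    calc 8 * w * √(t : ℝ) ≤ 8 * w * (96 * (n : ℝ) ^ 2 * n.factorial * w / deltaMin A) := by gcongr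
      _ = exploreBound T A := by rw [exploreBound, ← hw2]; field_simp; ring
  -- Below 7 the round ⌊4t/25⌋ is 0 and no test is available; there √t ≤ 3 is absorbed by the
  -- constant.
  rcases Nat.lt_or_ge t 7 with h7 | h7
  · have h1 : √(t : ℝ) ≤ 3 := by
      rw [Real.sqrt_le_left (by norm_num)]
      have : (t : ℝ) < 7 := by exact_mod_cast h7
      linarith
    have h2 : (1 / 2 : ℝ) ≤ w := by
      rw [hw]
      refine Real.le_sqrt_of_sq_le ?_
      have := log_two_le_log h.two_le h.one_le_horizon
      have := Real.log_two_gt_d9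
      linarith
    have h3 := h.one_le_scaled
    have h4 : (4 : ℝ) ≤ (n : ℝ) ^ 2 := by nlinarith
    calc √(t : ℝ) ≤ 3 := h1
      _ ≤ 96 * 4 * (1 / 2) * 1 := by norm_num
      _ ≤ 96 * (n : ℝ) ^ 2 * w * (n.factorial / deltaMin A) := by gcongr
      _ = _ := by ring
  -- The last round m with 6.25 m ≤ t: its test must have been negative, for otherwise exploration
  -- would have ended. Since t ≤ 16 m, the constant is 96 = 12 · 2 · 4.
  · set m := 4 * t / 25 with hm
    have hm1 : 1 ≤ m := by omega
    have hmt : (25 / 4 : ℝ) * m ≤ t := by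
      have : 25 * m ≤ 4 * t := Nat.mul_div_le _ _
      have : (25 : ℝ) * m ≤ 4 * t := by exact_mod_cast this
      linarith
    have hmt' : (t : ℝ) ≤ 4 ^ 2 * m := by
      have : t ≤ 16 * m := by omega
      have : (t : ℝ) ≤ 16 * m := by exact_mod_cast this
      linarith
    have hns : ¬ StopTest T m (empMean B m) := fun hc => by
      have := hs m hm1 (by omega) hc
      linarith
    have e := h.deltaMin_le_of_not_stopTest hm1 (by omega) hns
    have hm0 : 0 < √(m : ℝ) := Real.sqrt_pos.2 (by exact_mod_cast hm1)
    rw [confWidth_eq, ← hw, ← mul_div_assoc, le_div_iff₀ hm0] at e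
    have e2 : √(t : ℝ) ≤ 4 * √(m : ℝ) := by
      refine (Real.sqrt_le_sqrt hmt').trans (le_of_eq ?_)
      rw [Real.sqrt_mul (by norm_num), Real.sqrt_sq (by norm_num)]
    rw [le_div_iff₀ hd]
    nlinarith

end GoodPath

/-! ### Transitions of the algorithm -/

namespace AlgState

variable {nash : Matrix (Fin n) (Fin n) ℝ → (Fin n → ℝ) × (Fin n → ℝ)} {T t : ℕ} {s : AlgState n}
  {B M : Matrix (Fin n) (Fin n) ℝ}

/-- The state s' is left unspecified because a call overwrites every component that the invariant
for the subroutine inspects. -/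
lemma step_explore_call (phase : s.phase = Phase.explore) (ht : s.rounds + 1 = t)
    (hM : (1 / ((s.rounds + 1 : ℕ) : ℝ)) • (s.total + B) = M) (j : Fin n)
    (hc : tstarUpdate T t M s.tstar ≤ t) (hU : HasUniqueFullNash M) :
    ∃ s', s.step nash T B j = AlgState.callSub nash T t M s' := by
  subst ht hM
  simp only [AlgState.step, phase]
  exact ⟨_, if_pos ⟨hc, hU⟩⟩

lemma step_explore_stay (phase : s.phase = Phase.explore) (ht : s.rounds + 1 = t)
    (hM : (1 / ((s.rounds + 1 : ℕ) : ℝ)) • (s.total + B) = M) (j : Fin n)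
    (hc : ¬ tstarUpdate T t M s.tstar ≤ t) :
    s.step nash T B j = { s with
      rounds := t, total := s.total + B, next := (nash M).1,
      tstar := tstarUpdate T t M s.tstar, phase := Phase.explore } := by
  subst ht hM
  simp only [AlgState.step, phase]
  exact (if_neg fun h => hc h.1).trans (if_neg hc)

lemma step_sub_call (phase : s.phase = Phase.sub)
    (hM : (1 / ((s.rounds + 1 : ℕ) : ℝ)) • (s.total + B) = M) (j : Fin n)
    (hc : s.par.T₂ ≤ s.obs + 1) :
    ∃ s', s.step nash T B j = AlgState.callSub nash T (2 * s.t₁) M s' := by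
  subst hM
  simp only [AlgState.step, phase]
  exact ⟨_, if_pos hc⟩

lemma step_sub_stay (phase : s.phase = Phase.sub)
    (hM : (1 / ((s.rounds + 1 : ℕ) : ℝ)) • (s.total + B) = M) (j : Fin n)
    (hc : ¬ s.par.T₂ ≤ s.obs + 1) :
    s.step nash T B j = { s with
      rounds := s.rounds + 1, total := s.total + B, next := (nash M).1,
      phase := Phase.sub, δ := s.par.update s.δ j, obs := s.obs + 1 } := by
  subst hM
  simp only [AlgState.step, phase]
  exact if_neg hc

lemma step_plugIn (phase : s.phase = Phase.plugIn)
    (hM : (1 / ((s.rounds + 1 : ℕ) : ℝ)) • (s.total + B) = M) (j : Fin n) :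
    s.step nash T B j = { s with
      rounds := s.rounds + 1, total := s.total + B, next := (nash M).1,
      phase := Phase.plugIn } := by
  subst hM
  simp only [AlgState.step, phase]

end AlgState

/-- The state of the algorithm after `t` rounds with cumulative regret at most `R`, on a path with
accurate empirical means. -/
inductive PathInv (nash : Matrix (Fin n) (Fin n) ℝ → (Fin n → ℝ) × (Fin n → ℝ)) (T : ℕ)
    (B : ℕ → Matrix (Fin n) (Fin n) ℝ) (A : Matrix (Fin n) (Fin n) ℝ) (xs ys : Fin n → ℝ)
    (t : ℕ) (s : AlgState n) (R : ℝ) : Prop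
  | explore (phase : s.phase = Phase.explore)
      (test : TestInv T t (fun τ => StopTest T τ (empMean B τ)) s.tstar)
      (next : (t = 0 ∧ s.next ∈ stdSimplex ℝ (Fin n)) ∨
        (1 ≤ t ∧ (t : ℝ) < s.tstar ∧ s.next = (nash (empMean B t)).1))
      (regret : R ≤ 1 + 8 * √(Real.log (n * T)) * √((t : ℝ) - 1))
  | sub (k : ℕ) (phase : s.phase = Phase.sub) (pow_le : 2 ^ k ≤ s.t₁) (time : s.t₁ + s.obs = t)
      (obs_lt : s.obs < min s.t₁ (T - s.t₁)) (par : s.par = subCall nash T s.t₁ (empMean B s.t₁))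
      (acc : Accurate nash T s.t₁ A (empMean B s.t₁) xs ys) (hδ : ∀ i, |s.δ i| ≤ s.par.radius)
      (regret : R + s.par.potential (xs - (nash (empMean B s.t₁)).1) s.δ ≤
        1 + exploreBound T A + k * callBound T A + n * (2 * s.par.radius ^ 2 / s.par.eta)
          + s.obs * (n * (s.par.eta / 2 + 4 * s.par.radius * confWidth n T s.t₁)))
  | done (k : ℕ) (time : t = T) (pow_le : 2 ^ k ≤ 2 * T)
      (regret : R ≤ 1 + exploreBound T A + k * callBound T A)

/-! ### Preservation of the invariant and the pathwise regret bound -/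

namespace GoodPath

variable {nash : Matrix (Fin n) (Fin n) ℝ → (Fin n → ℝ) × (Fin n → ℝ)} {T : ℕ}
  {B : ℕ → Matrix (Fin n) (Fin n) ℝ} {A : Matrix (Fin n) (Fin n) ℝ} {xs ys : Fin n → ℝ}

/-- It makes the per-round losses 2 w_t of the empirical equilibria telescope. -/
lemma sqrt_step {t : ℕ} (ht : 1 ≤ t) : 1 / √(t : ℝ) ≤ 2 * (√(t : ℝ) - √((t : ℝ) - 1)) := by
  have h1 : (1 : ℝ) ≤ t := by exact_mod_cast ht
  have h2 : 0 < √(t : ℝ) := Real.sqrt_pos.2 (by linarith)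
  rw [div_le_iff₀ h2]
  have h3 := Real.sq_sqrt (show (0 : ℝ) ≤ t by linarith)
  have h4 := Real.sq_sqrt (show (0 : ℝ) ≤ t - 1 by linarith)
  nlinarith [sq_nonneg (√(t : ℝ) - √((t : ℝ) - 1))]

/-- The uniform first strategy costs at most 1. The strategy computed from t ≥ 1 matrices costs 2
w_t, which pays for the passage from √(t - 1) to √t. At t = 0 the term √(t - 1) is 0 by convention.
-/
lemma explore_regret (h : GoodPath nash T B A xs ys) {t : ℕ} {s : AlgState n} {R : ℝ}
    (ht : t < T) (hphase : s.phase = Phase.explore)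
    (next : (t = 0 ∧ s.next ∈ stdSimplex ℝ (Fin n)) ∨
        (1 ≤ t ∧ (t : ℝ) < s.tstar ∧ s.next = (nash (empMean B t)).1))
    (hR0 : t = 0 → R = 0) (regret : R ≤ 1 + 8 * √(Real.log (n * T)) * √((t : ℝ) - 1))
    (j : Fin n) :
    R + (xs ⬝ᵥ (A *ᵥ ys) - (s.play ᵥ* A) j) ≤ 1 + 8 * √(Real.log (n * T)) * √(t : ℝ) := by
  have hp : s.play = s.next := by rw [AlgState.play, hphase]
  rw [hp]
  rcases next with ⟨h0, hmem⟩ | ⟨h1, -, hnext⟩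
  · have e1 := (vecMul_mem_Icc h.mem hmem j).1
    have e2 := (value_mem_Icc h.mem h.unique.1.1 h.unique.1.2.1).2
    have e3 : 0 ≤ 8 * √(Real.log (n * T)) * √(t : ℝ) := by positivity
    linarith [hR0 h0]
  · have e1 := (h.close h1 ht.le).value_sub_le_vecMul h.unique.1 (h.isNash _) j
    rw [hnext]
    have e2 := sqrt_step h1
    have e3 : confWidth n T t = 2 * √(Real.log (n * T)) * (1 / √t) := by
      rw [confWidth_eq, mul_one_div]
    have e4 := mul_le_mul_of_nonneg_left e2
      (show 0 ≤ 2 * √(Real.log ((n : ℝ) * T)) by positivity)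
    rw [← e3] at e4
    linarith

lemma callBound_nonneg (h : GoodPath nash T B A xs ys) : 0 ≤ callBound T A := by
  have := h.log_pos
  rw [callBound]
  positivity

variable [NeZero n]

lemma pathInv_callSub (h : GoodPath nash T B A xs ys) {u k : ℕ} {R : ℝ} (s : AlgState n)
    (hu : 1 ≤ u) (huT : u ≤ T) (hk : 2 ^ k ≤ u)
    (hacc : 20 * (n : ℝ) ^ 2 * n.factorial * confWidth n T u ≤ deltaMinTilde A)
    (hR : R ≤ 1 + exploreBound T A + k * callBound T A) :
    PathInv nash T B A xs ys u (s.callSub nash T u (empMean B u)) R := by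
  -- A call made exactly at the horizon has no rounds to play, so the run counts as finished.
  rcases huT.eq_or_lt with rfl | hlt
  · exact .done k rfl (by omega) hR
  · have acc : Accurate nash T u A (empMean B u) xs ys :=
      ⟨h.two_le, h.one_le_horizon, hu, h.isNash, h.unique, h.close hu huT, hacc⟩
    refine .sub k rfl hk rfl (lt_min hu (Nat.sub_pos_of_lt hlt)) rfl acc (fun i => ?_) ?_
    · show |-(subCall nash T u (empMean B u)).radius| ≤ (subCall nash T u (empMean B u)).radius
      rw [abs_neg, abs_of_pos acc.radius_pos]
    · have := SubParams.potential_init_le acc.eta_pos acc.abs_comparator_le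
      show R + (subCall nash T u (empMean B u)).potential (xs - (nash (empMean B u)).1)
        (subCall nash T u (empMean B u)).init ≤ 1 + exploreBound T A + k * callBound T A
          + n * (2 * (subCall nash T u (empMean B u)).radius ^ 2 /
            (subCall nash T u (empMean B u)).eta)
          + ((0 : ℕ) : ℝ) * _
      rw [Nat.cast_zero, zero_mul, add_zero]
      linarith

lemma explore_bound (h : GoodPath nash T B A xs ys) {t : ℕ} {u : ℝ} (ht : t ≤ T)
    (test : TestInv T t (fun τ => StopTest T τ (empMean B τ)) u) (hu : t = 0 ∨ (t : ℝ) < u) :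
    8 * √(Real.log (n * T)) * √(t : ℝ) ≤ exploreBound T A := by
  refine h.explore_le ht fun τ h1 h2 h3 => ?_
  have htT : (t : ℝ) ≤ T := by exact_mod_cast ht
  rcases test.bound τ h1 h2 h3 with h4 | h4
  · rcases hu with h5 | h5
    · omega
    · exact h5.trans_le h4
  · linarith

lemma accurate_of_tstar_le (h : GoodPath nash T B A xs ys) {t : ℕ} {u : ℝ} (ht : t ≤ T)
    (test : TestInv T t (fun τ => StopTest T τ (empMean B τ)) u) (hu : u ≤ (t : ℝ)) :
    20 * (n : ℝ) ^ 2 * n.factorial * confWidth n T t ≤ deltaMinTilde A := by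
  have htT : (t : ℝ) ≤ T := by exact_mod_cast ht
  rcases test.origin with h1 | ⟨τ, h1, h2, h3, h4⟩
  · linarith
  · exact h.le_deltaMinTilde_of_stopTest h1 (h4 ▸ hu) ht h3

/-- On an accurate path the branch that keeps playing empirical equilibria is never entered, which
is why the invariant has no case for it. -/
lemma hasUniqueFullNash (h : GoodPath nash T B A xs ys) {t : ℕ} (h1 : 1 ≤ t) (h2 : t ≤ T)
    (hacc : 20 * (n : ℝ) ^ 2 * n.factorial * confWidth n T t ≤ deltaMinTilde A) :
    HasUniqueFullNash (empMean B t) :=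
  ⟨_, _, Accurate.uniqueFullNash
    ⟨h.two_le, h.one_le_horizon, h1, h.isNash, h.unique, h.close h1 h2, hacc⟩⟩

lemma pathInv_step (h : GoodPath nash T B A xs ys) {t : ℕ} {s : AlgState n} {R : ℝ} (ht : t < T)
    (hmean : (1 / ((s.rounds + 1 : ℕ) : ℝ)) • (s.total + B t) = empMean B (t + 1))
    (hrounds : s.rounds = t) (hR0 : t = 0 → R = 0) (hI : PathInv nash T B A xs ys t s R)
    (j : Fin n) :
    PathInv nash T B A xs ys (t + 1) (s.step nash T (B t) j)
      (R + (xs ⬝ᵥ (A *ᵥ ys) - (s.play ᵥ* A) j)) := by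
  cases hI with
  | explore phase test next regret =>
    have hR := h.explore_regret ht phase next hR0 regret j
    have hb := h.explore_bound ht.le test (by
      rcases next with h0 | h0
      · exact Or.inl h0.1
      · exact Or.inr h0.2.1)
    have test' := test.update
    by_cases hc : tstarUpdate T (t + 1) (empMean B (t + 1)) s.tstar ≤ ((t + 1 : ℕ) : ℝ)
    · have hacc := h.accurate_of_tstar_le ht test' hc
      obtain ⟨s', hs'⟩ := AlgState.step_explore_call (nash := nash) phase (by rw [hrounds]) hmean j
        hc (h.hasUniqueFullNash (by omega) ht hacc)
      rw [hs']
      exact h.pathInv_callSub (k := 0) _ (by omega) ht (by simp) hacc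
        (by rw [Nat.cast_zero, zero_mul, add_zero]; linarith)
    · rw [AlgState.step_explore_stay phase (by rw [hrounds]) hmean j hc]
      refine .explore rfl test' (Or.inr ⟨by omega, not_le.1 hc, rfl⟩) ?_
      rw [Nat.cast_add, Nat.cast_one, add_sub_cancel_right]
      exact hR
  | sub k phase pow_le time obs_lt par acc hδ regret =>
    have hplay : s.play = s.par.play s.δ := by rw [AlgState.play, phase]
    have hT₂ : s.par.T₂ = min s.t₁ (T - s.t₁) := by rw [par]; rfl
    have hr : 0 < s.par.radius := by rw [par]; exact acc.radius_pos
    have hη : 0 < s.par.eta := by rw [par]; exact acc.eta_pos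
    have hstep := acc.regret_step (δ := s.δ) (by rw [← par]; exact hδ) j
    have hbudget := acc.budget_le (m := s.obs + 1) (by omega)
    rw [← par] at hstep hbudget
    rw [Nat.cast_add, Nat.cast_one] at hbudget
    have hpot := SubParams.potential_nonneg hη.le (xs - (nash (empMean B s.t₁)).1)
      (s.par.update s.δ j)
    rw [hplay]
    by_cases hc : s.par.T₂ ≤ s.obs + 1
    · obtain ⟨s', hs'⟩ := AlgState.step_sub_call (nash := nash) (T := T) phase hmean j hc
      rw [hs']
      have hRk : R + (xs ⬝ᵥ (A *ᵥ ys) - (s.par.play s.δ ᵥ* A) j) ≤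
          1 + exploreBound T A + ((k + 1 : ℕ) : ℝ) * callBound T A := by
        push_cast
        linarith
      -- The call has just used up T₂ rounds and its budget, and its remaining potential is dropped.
      -- If 2t₁ ≤ T then T₂ = t₁ and the current round is exactly 2t₁, the index of the mean passed
      -- to the next call; otherwise T₂ = T - t₁ and the horizon is reached.
      by_cases hd : 2 * s.t₁ ≤ T
      · have ht2 : t + 1 = 2 * s.t₁ := by omega
        rw [ht2]
        refine h.pathInv_callSub _ (by omega) hd (by rw [pow_succ]; omega) ?_ hRk
        refine le_trans ?_ acc.le_deltaMinTilde
        have := confWidth_anti (n := n) (T := T) acc.one_le_time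
          (show s.t₁ ≤ 2 * s.t₁ by omega)
        gcongr
      · exact .done (k + 1) (by omega) (by rw [pow_succ]; omega) hRk
    · rw [AlgState.step_sub_stay phase hmean j hc]
      refine .sub k rfl pow_le ?_ ?_ par acc (fun i => SubParams.abs_update_le hr.le _ _ _) ?_
      · show s.t₁ + (s.obs + 1) = t + 1
        omega
      · show s.obs + 1 < min s.t₁ (T - s.t₁)
        omega
      · show _ ≤ _ + ((s.obs + 1 : ℕ) : ℝ) * _
        push_cast
        linarith
  | done k time pow_le regret => omega

lemma pathInv (h : GoodPath nash T B A xs ys) (j : ℕ → Fin n) {t : ℕ} (ht : t ≤ T) :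
    PathInv nash T B A xs ys t (algState nash T B j t)
      (∑ s ∈ Finset.range t, (xs ⬝ᵥ (A *ᵥ ys) - (algPlay nash T B j s ᵥ* A) (j s))) := by
  induction t with
  | zero =>
    refine .explore rfl ⟨Or.inl rfl, fun τ h1 h2 => by omega⟩ (Or.inl ⟨rfl, ?_⟩) ?_
    · refine ⟨fun i => ?_, ?_⟩
      · show 0 ≤ 1 / (n : ℝ)
        positivity
      · show ∑ _ : Fin n, 1 / (n : ℝ) = 1
        simp [NeZero.ne n]
    · rw [Finset.sum_range_zero]
      positivity
  | succ t ih =>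
    rw [Finset.sum_range_succ]
    exact h.pathInv_step (by omega) (algState_mean nash T B j t)
      (algState_rounds_total nash T B j t).1 (by rintro rfl; simp) (ih (by omega)) (j t)

/-- The regret on a path with accurate empirical means. -/
theorem regret_le (h : GoodPath nash T B A xs ys) (j : ℕ → Fin n) :
    ∑ s ∈ Finset.range T, (xs ⬝ᵥ (A *ᵥ ys) - (algPlay nash T B j s ᵥ* A) (j s)) ≤
      1 + exploreBound T A + 3 / 2 * Real.log (n * T) * callBound T A := by
  have hL := h.log_pos
  have hC := h.callBound_nonneg
  -- The calls double t₁, so k ≤ log₂(2T) ≤ log₂(nT), and 1/log 2 < 3/2.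
  have key : ∀ k : ℕ, 2 ^ k ≤ 2 * T → (k : ℝ) ≤ 3 / 2 * Real.log (n * T) := by
    intro k hk
    have hk' : (2 : ℝ) ^ k ≤ n * T := by
      have h1 : 2 ^ k ≤ n * T := hk.trans (Nat.mul_le_mul_right T h.two_le)
      exact_mod_cast h1
    have h2 := Real.log_le_log (by positivity) hk'
    rw [Real.log_pow] at h2
    have := Real.log_two_gt_d9
    have : (0 : ℝ) ≤ k := Nat.cast_nonneg k
    nlinarith
  have hI := h.pathInv j (le_refl T)
  generalize ∑ s ∈ Finset.range T, (xs ⬝ᵥ (A *ᵥ ys) - (algPlay nash T B j s ᵥ* A) (j s)) = R at hI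
  cases hI with
  | explore phase test next regret =>
    have hb := h.explore_bound le_rfl test (by
      rcases next with h0 | h0
      · exact Or.inl h0.1
      · exact Or.inr h0.2.1)
    have : 8 * √(Real.log (n * T)) * √((T : ℝ) - 1) ≤ 8 * √(Real.log (n * T)) * √(T : ℝ) := by
      gcongr
      linarith
    have : 0 ≤ 3 / 2 * Real.log (n * T) * callBound T A := by positivity
    linarith
  | sub k phase pow_le time obs_lt par acc hδ regret => omega
  | done k time pow_le regret =>
    have := mul_le_mul_of_nonneg_right (key k pow_le) hC
    linarith

end GoodPath

/-! ### The algorithm plays mixed strategies -/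

section Simplex

variable {nash : Matrix (Fin n) (Fin n) ℝ → (Fin n → ℝ) × (Fin n → ℝ)}

lemma AlgState.step_mem (hnash : ∀ M, IsNash M (nash M).1 (nash M).2) (T : ℕ) {s : AlgState n}
    (hs : s.phase = Phase.sub → s.par.x' ∈ stdSimplex ℝ (Fin n))
    (B : Matrix (Fin n) (Fin n) ℝ) (j : Fin n) :
    (s.step nash T B j).next ∈ stdSimplex ℝ (Fin n) ∧
      ((s.step nash T B j).phase = Phase.sub →
        (s.step nash T B j).par.x' ∈ stdSimplex ℝ (Fin n)) := by
  have hN := (hnash ((1 / ((s.rounds + 1 : ℕ) : ℝ)) • (s.total + B))).1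
  cases h : s.phase with
  | explore =>
    simp only [AlgState.step, h]
    split_ifs
    · exact ⟨hN, fun _ => hN⟩
    · exact ⟨hN, fun h' => by cases h'⟩
    · exact ⟨hN, fun h' => by cases h'⟩
  | plugIn =>
    rw [AlgState.step_plugIn h rfl]
    exact ⟨hN, fun h' => by cases h'⟩
  | sub =>
    by_cases hc : s.par.T₂ ≤ s.obs + 1
    · simp only [AlgState.step, h]
      rw [if_pos hc]
      exact ⟨hN, fun _ => hN⟩
    · rw [AlgState.step_sub_stay h rfl _ hc]
      exact ⟨hN, fun _ => hs h⟩

lemma algPlay_mem [NeZero n] (hnash : ∀ M, IsNash M (nash M).1 (nash M).2) (T : ℕ)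
    (B : ℕ → Matrix (Fin n) (Fin n) ℝ) (j : ℕ → Fin n) (t : ℕ) :
    algPlay nash T B j t ∈ stdSimplex ℝ (Fin n) := by
  have h : (algState nash T B j t).next ∈ stdSimplex ℝ (Fin n) ∧
      ((algState nash T B j t).phase = Phase.sub →
        (algState nash T B j t).par.x' ∈ stdSimplex ℝ (Fin n)) := by
    induction t with
    | zero =>
      refine ⟨⟨fun i => ?_, ?_⟩, fun h => by cases h⟩
      · show 0 ≤ 1 / (n : ℝ)
        positivity
      · show ∑ _ : Fin n, 1 / (n : ℝ) = 1
        simp [NeZero.ne n]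
    | succ t ih => exact AlgState.step_mem hnash T ih.2 (B t) (j t)
  rw [algPlay, AlgState.play]
  cases hp : (algState nash T B j t).phase with
  | explore => exact h.1
  | plugIn => exact h.1
  | sub => exact SubParams.play_mem (h.2 hp) _

end Simplex

/-! ### Measurability of the algorithm -/

section Measurability

variable {Ω : Type*} {m : MeasurableSpace Ω}

lemma measurable_det {M : Ω → Matrix (Fin n) (Fin n) ℝ} (hM : ∀ i k, Measurable fun ω => M ω i k) :
    Measurable fun ω => (M ω).det := by
  simp_rw [Matrix.det_apply']
  exact Finset.measurable_sum _ fun σ _ =>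
    (Finset.measurable_prod _ fun i _ => hM _ _).const_mul _

lemma measurable_cramerMat {M : Ω → Matrix (Fin n) (Fin n) ℝ}
    (hM : ∀ i k, Measurable fun ω => M ω i k) (i k : Fin n) :
    Measurable fun ω => cramerMat (M ω) i k := by
  simp only [cramerMat, Matrix.of_apply]
  split_ifs
  · exact (hM _ _).sub (hM _ _)
  · exact measurable_const

lemma measurable_cramerMatCol {M : Ω → Matrix (Fin n) (Fin n) ℝ}
    (hM : ∀ i k, Measurable fun ω => M ω i k) (l i k : Fin n) :
    Measurable fun ω => cramerMatCol (M ω) l i k := by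
  simp only [cramerMatCol, Matrix.updateCol_apply]
  split_ifs
  · exact measurable_const
  · exact measurable_cramerMat hM i k

lemma measurable_cramerSol {M : Ω → Matrix (Fin n) (Fin n) ℝ}
    (hM : ∀ i k, Measurable fun ω => M ω i k) (l : Fin n) :
    Measurable fun ω => cramerSol (M ω) l :=
  (measurable_det (measurable_cramerMatCol hM l)).div (measurable_det (measurable_cramerMat hM))

lemma measurable_deltaMinTilde {M : Ω → Matrix (Fin n) (Fin n) ℝ}
    (hM : ∀ i k, Measurable fun ω => M ω i k) : Measurable fun ω => deltaMinTilde (M ω) := by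
  have hM' : ∀ i k, Measurable fun ω => (M ω)ᵀ i k := fun i k => hM k i
  have habs : ∀ {f : Ω → ℝ}, Measurable f → Measurable fun ω => |f ω| := fun hf => hf.abs
  unfold deltaMinTilde deltaMin
  exact ((habs (measurable_det (measurable_cramerMat hM'))).min
    (habs (measurable_det (measurable_cramerMat hM)))).min
    ((Measurable.iInf fun i => habs (measurable_det (measurable_cramerMatCol hM' i))).min
      (Measurable.iInf fun i => habs (measurable_det (measurable_cramerMatCol hM i))))

lemma measurableSet_hasUniqueFullNash [NeZero n] {M : Ω → Matrix (Fin n) (Fin n) ℝ}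
    (hM : ∀ i k, Measurable fun ω => M ω i k) :
    MeasurableSet {ω | HasUniqueFullNash (M ω)} := by
  have hM' : ∀ i k, Measurable fun ω => (M ω)ᵀ i k := fun i k => hM k i
  simp_rw [hasUniqueFullNash_iff, Set.ofPred_and, Set.ofPred_forall]
  refine .inter ?_ (.inter ?_ (.inter (.iInter fun i => ?_) (.iInter fun i => ?_)))
  · exact (measurableSet_eq_fun (measurable_det (measurable_cramerMat hM')) measurable_const).compl
  · exact (measurableSet_eq_fun (measurable_det (measurable_cramerMat hM)) measurable_const).compl
  · exact measurableSet_lt measurable_const (measurable_cramerSol hM' i)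
  · exact measurableSet_lt measurable_const (measurable_cramerSol hM i)

lemma measurableSet_stopTest (T : ℕ) {t : Ω → ℕ} (ht : Measurable t)
    {M : Ω → Matrix (Fin n) (Fin n) ℝ} (hM : ∀ i k, Measurable fun ω => M ω i k) :
    MeasurableSet {ω | StopTest T (t ω) (M ω)} := by
  have hw : Measurable fun ω => 2 * (n : ℝ) ^ 2 * (n.factorial : ℝ) * confWidth n T (t ω) :=
    ((Measurable.of_discrete (f := fun t => confWidth n T t)).comp ht).const_mul _
  have hd := measurable_deltaMinTilde hM
  have hq := (hd.add hw).div (hd.sub hw)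
  exact (measurableSet_le measurable_const hq).inter (measurableSet_le hq measurable_const)

lemma measurable_tstarUpdate (T : ℕ) {t : Ω → ℕ} (ht : Measurable t)
    {M : Ω → Matrix (Fin n) (Fin n) ℝ} (hM : ∀ i k, Measurable fun ω => M ω i k) {u : Ω → ℝ}
    (hu : Measurable u) : Measurable fun ω => tstarUpdate T (t ω) (M ω) (u ω) :=
  Measurable.ite ((measurableSet_stopTest T ht hM).inter (measurableSet_lt measurable_const hu))
    (((Measurable.of_discrete (f := fun t : ℕ => (t : ℝ))).comp ht).const_mul _) hu

lemma measurable_fullDelta {δ : Ω → Fin n → ℝ} (hδ : Measurable δ) :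
    Measurable fun ω => SubParams.fullDelta (δ ω) := by
  refine measurable_pi_iff.2 fun i => ?_
  simp only [SubParams.fullDelta]
  split_ifs
  · exact (measurable_pi_apply i).comp hδ
  · exact (Finset.measurable_sum _ fun k _ => (measurable_pi_apply k).comp hδ).neg

lemma measurable_apply_index {f : Ω → Fin n → ℝ} (hf : ∀ k, Measurable fun ω => f ω k)
    {j : Ω → Fin n} (hj : Measurable j) : Measurable fun ω => f ω (j ω) := by
  have h : (fun ω => f ω (j ω)) = fun ω => ∑ k, if j ω = k then f ω k else 0 := by
    funext ω; simp
  rw [h]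
  exact Finset.measurable_sum _ fun k _ =>
    Measurable.ite (hj (measurableSet_singleton k)) (hf k) measurable_const

instance : MeasurableSpace Phase := ⊤

/-- A random state of the algorithm, all of whose components are measurable. -/
structure MeasState (m : MeasurableSpace Ω) (s : Ω → AlgState n) : Prop where
  rounds : Measurable fun ω => (s ω).rounds
  total : ∀ i k, Measurable fun ω => (s ω).total i k
  tstar : Measurable fun ω => (s ω).tstar
  phase : Measurable fun ω => (s ω).phase
  next : Measurable fun ω => (s ω).next
  t₁ : Measurable fun ω => (s ω).t₁
  x' : Measurable fun ω => (s ω).par.x'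
  Ahat : ∀ i k, Measurable fun ω => (s ω).par.Ahat i k
  D₁ : Measurable fun ω => (s ω).par.D₁
  T₁ : Measurable fun ω => (s ω).par.T₁
  T₂ : Measurable fun ω => (s ω).par.T₂
  δ : Measurable fun ω => (s ω).δ
  obs : Measurable fun ω => (s ω).obs

lemma measurable_apply_ite {α β : Type*} [MeasurableSpace β] {p : Ω → Prop} [DecidablePred p]
    (hp : MeasurableSet {ω | p ω}) (f : α → β) {s s' : Ω → α} (hs : Measurable fun ω => f (s ω))
    (hs' : Measurable fun ω => f (s' ω)) : Measurable fun ω => f (if p ω then s ω else s' ω) := by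
  simp_rw [apply_ite f]
  exact Measurable.ite hp hs hs'

namespace MeasState

lemma ite {p : Ω → Prop} [DecidablePred p] (hp : MeasurableSet {ω | p ω}) {s s' : Ω → AlgState n}
    (hs : MeasState m s) (hs' : MeasState m s') :
    MeasState m fun ω => if p ω then s ω else s' ω where
  rounds := measurable_apply_ite hp AlgState.rounds hs.rounds hs'.rounds
  total i k := measurable_apply_ite hp (fun s : AlgState n => s.total i k) (hs.total i k)
    (hs'.total i k)
  tstar := measurable_apply_ite hp AlgState.tstar hs.tstar hs'.tstar
  phase := measurable_apply_ite hp AlgState.phase hs.phase hs'.phase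
  next := measurable_apply_ite hp AlgState.next hs.next hs'.next
  t₁ := measurable_apply_ite hp AlgState.t₁ hs.t₁ hs'.t₁
  x' := measurable_apply_ite hp (fun s : AlgState n => s.par.x') hs.x' hs'.x'
  Ahat i k := measurable_apply_ite hp (fun s : AlgState n => s.par.Ahat i k) (hs.Ahat i k)
    (hs'.Ahat i k)
  D₁ := measurable_apply_ite hp (fun s : AlgState n => s.par.D₁) hs.D₁ hs'.D₁
  T₁ := measurable_apply_ite hp (fun s : AlgState n => s.par.T₁) hs.T₁ hs'.T₁
  T₂ := measurable_apply_ite hp (fun s : AlgState n => s.par.T₂) hs.T₂ hs'.T₂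
  δ := measurable_apply_ite hp AlgState.δ hs.δ hs'.δ
  obs := measurable_apply_ite hp AlgState.obs hs.obs hs'.obs

lemma radius {s : Ω → AlgState n} (hs : MeasState m s) : Measurable fun ω => (s ω).par.radius :=
  (hs.D₁.mul hs.T₁.sqrt).const_div 1

lemma eta {s : Ω → AlgState n} (hs : MeasState m s) : Measurable fun ω => (s ω).par.eta :=
  (hs.D₁.mul hs.T₁).const_div 1

lemma update {s : Ω → AlgState n} (hs : MeasState m s) {j : Ω → Fin n} (hj : Measurable j) :
    Measurable fun ω => (s ω).par.update (s ω).δ (j ω) := by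
  refine measurable_pi_iff.2 fun i => ?_
  have h1 := hs.radius
  have h2 : ∀ l : Fin n, Measurable fun ω => (s ω).par.Ahat l (j ω) := fun l =>
    measurable_apply_index (hs.Ahat l) hj
  exact h1.neg.max (h1.min (((measurable_pi_apply i).comp hs.δ).add
    (hs.eta.mul ((h2 i).sub (h2 _)))))

lemma play {s : Ω → AlgState n} (hs : MeasState m s) : Measurable fun ω => (s ω).play := by
  classical
  have h1 : Measurable fun ω => (s ω).par.x' + SubParams.fullDelta (s ω).δ :=
    hs.x'.add (measurable_fullDelta hs.δ)
  have h2 : Measurable fun ω => (s ω).par.play (s ω).δ :=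
    Measurable.ite (h1 (isClosed_stdSimplex ℝ (Fin n)).measurableSet) h1 hs.x'
  have e : (fun ω => (s ω).play) =
      fun ω => if (s ω).phase = Phase.sub then (s ω).par.play (s ω).δ else (s ω).next := by
    funext ω
    rw [AlgState.play]
    cases h : (s ω).phase <;> simp
  rw [e]
  exact Measurable.ite (hs.phase (MeasurableSpace.measurableSet_top (s := {Phase.sub}))) h2 hs.next

variable {nash : Matrix (Fin n) (Fin n) ℝ → (Fin n → ℝ) × (Fin n → ℝ)}

lemma measurable_nash
    (hnash : Measurable fun M : Fin n → Fin n → ℝ => nash (Matrix.of M))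
    {M : Ω → Matrix (Fin n) (Fin n) ℝ} (hM : ∀ i k, Measurable fun ω => M ω i k) :
    Measurable fun ω => (nash (M ω)).1 :=
  (hnash.comp (measurable_pi_iff.2 fun i => measurable_pi_iff.2 fun k => hM i k)).fst

lemma callSub (hnash : Measurable fun M : Fin n → Fin n → ℝ => nash (Matrix.of M)) (T : ℕ)
    {s : Ω → AlgState n} (hs : MeasState m s) {u : Ω → ℕ} (hu : Measurable u)
    {M : Ω → Matrix (Fin n) (Fin n) ℝ} (hM : ∀ i k, Measurable fun ω => M ω i k) :
    MeasState m fun ω => (s ω).callSub nash T (u ω) (M ω) := by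
  have hM' : ∀ i k, Measurable fun ω => (M ω)ᵀ i k := fun i k => hM k i
  have hD : Measurable fun ω => |(cramerMat (M ω)ᵀ).det| / (5 * n * n.factorial) :=
    (measurable_det (measurable_cramerMat hM')).abs.div_const _
  have hT : Measurable fun ω => (1 / confWidth n T (u ω)) ^ 2 :=
    (Measurable.of_discrete (f := fun t => (1 / confWidth n T t) ^ 2)).comp hu
  refine ⟨hs.rounds, hs.total, hs.tstar, measurable_const, hs.next, hu, measurable_nash hnash hM,
    hM, hD, hT, (Measurable.of_discrete (f := fun t => min t (T - t))).comp hu, ?_,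
    measurable_const⟩
  exact measurable_pi_iff.2 fun i => ((hD.mul hT.sqrt).const_div 1).neg

-- A form with nested conditionals in place of pattern matching, to which `MeasState.ite` applies
-- branch by branch.
open Classical in
lemma step_eq (nash : Matrix (Fin n) (Fin n) ℝ → (Fin n → ℝ) × (Fin n → ℝ)) (T : ℕ)
    (s : AlgState n) (B : Matrix (Fin n) (Fin n) ℝ) (j : Fin n) :
    s.step nash T B j =
      if s.phase = Phase.explore then
        if tstarUpdate T (s.rounds + 1) ((1 / ((s.rounds + 1 : ℕ) : ℝ)) • (s.total + B)) s.tstar ≤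
            ((s.rounds + 1 : ℕ) : ℝ) then
          if HasUniqueFullNash ((1 / ((s.rounds + 1 : ℕ) : ℝ)) • (s.total + B)) then
            AlgState.callSub nash T (s.rounds + 1) ((1 / ((s.rounds + 1 : ℕ) : ℝ)) • (s.total + B))
              { s with
                rounds := s.rounds + 1
                total := s.total + B
                next := (nash ((1 / ((s.rounds + 1 : ℕ) : ℝ)) • (s.total + B))).1
                tstar := tstarUpdate T (s.rounds + 1)
                  ((1 / ((s.rounds + 1 : ℕ) : ℝ)) • (s.total + B)) s.tstar }
          else
            { s with
              rounds := s.rounds + 1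
              total := s.total + B
              next := (nash ((1 / ((s.rounds + 1 : ℕ) : ℝ)) • (s.total + B))).1
              tstar := tstarUpdate T (s.rounds + 1)
                ((1 / ((s.rounds + 1 : ℕ) : ℝ)) • (s.total + B)) s.tstar
              phase := Phase.plugIn }
        else
          { s with
            rounds := s.rounds + 1
            total := s.total + B
            next := (nash ((1 / ((s.rounds + 1 : ℕ) : ℝ)) • (s.total + B))).1
            tstar := tstarUpdate T (s.rounds + 1)
              ((1 / ((s.rounds + 1 : ℕ) : ℝ)) • (s.total + B)) s.tstar }
      else if s.phase = Phase.plugIn then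
        { s with
          rounds := s.rounds + 1
          total := s.total + B
          next := (nash ((1 / ((s.rounds + 1 : ℕ) : ℝ)) • (s.total + B))).1 }
      else if s.par.T₂ ≤ s.obs + 1 then
        AlgState.callSub nash T (2 * s.t₁) ((1 / ((s.rounds + 1 : ℕ) : ℝ)) • (s.total + B))
          { s with
            rounds := s.rounds + 1
            total := s.total + B
            next := (nash ((1 / ((s.rounds + 1 : ℕ) : ℝ)) • (s.total + B))).1 }
      else
        { s with
          rounds := s.rounds + 1
          total := s.total + B
          next := (nash ((1 / ((s.rounds + 1 : ℕ) : ℝ)) • (s.total + B))).1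
          δ := s.par.update s.δ j
          obs := s.obs + 1 } := by
  cases h : s.phase with
  | explore =>
    simp only [AlgState.step, h, if_true]
    split_ifs with h1 h2 h3 h4 h5 <;> first | rfl | (exfalso; tauto)
  | plugIn =>
    simp only [AlgState.step, h, reduceCtorEq, if_true, if_false]
  | sub =>
    simp only [AlgState.step, h, reduceCtorEq, if_false]

lemma step [NeZero n] (hnash : Measurable fun M : Fin n → Fin n → ℝ => nash (Matrix.of M)) (T : ℕ)
    {s : Ω → AlgState n} (hs : MeasState m s) {B : Ω → Matrix (Fin n) (Fin n) ℝ}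
    (hB : ∀ i k, Measurable fun ω => B ω i k) {j : Ω → Fin n} (hj : Measurable j) :
    MeasState m fun ω => (s ω).step nash T (B ω) (j ω) := by
  classical
  have hr : Measurable fun ω => (s ω).rounds + 1 := hs.rounds.add_const 1
  have hr' : Measurable fun ω => (((s ω).rounds + 1 : ℕ) : ℝ) :=
    (Measurable.of_discrete (f := fun t : ℕ => (t : ℝ))).comp hr
  have htot : ∀ i k, Measurable fun ω => ((s ω).total + B ω) i k := fun i k =>
    (hs.total i k).add (hB i k)
  have hM : ∀ i k, Measurable fun ω =>
      ((1 / (((s ω).rounds + 1 : ℕ) : ℝ)) • ((s ω).total + B ω)) i k := fun i k =>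
    (hr'.const_div 1).mul (htot i k)
  have hnext := measurable_nash hnash hM
  have hts := measurable_tstarUpdate T hr hM hs.tstar
  have hobs : Measurable fun ω => (s ω).obs + 1 := hs.obs.add_const 1
  have ht1 : Measurable fun ω => 2 * (s ω).t₁ := hs.t₁.const_mul 2
  have hph : ∀ p : Phase, MeasurableSet {ω | (s ω).phase = p} := fun p =>
    hs.phase (MeasurableSpace.measurableSet_top (s := {p}))
  simp only [step_eq]
  refine ite (hph _) (ite (measurableSet_le hts hr') (ite (measurableSet_hasUniqueFullNash hM)
    (callSub hnash T ?_ hr hM) ?_) ?_) (ite (hph _) ?_ (ite (measurableSet_le hs.T₂ hobs)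
      (callSub hnash T ?_ ht1 hM) ?_))
  · exact ⟨hr, htot, hts, hs.phase, hnext, hs.t₁, hs.x', hs.Ahat, hs.D₁, hs.T₁, hs.T₂, hs.δ, hs.obs⟩
  · exact ⟨hr, htot, hts, measurable_const, hnext, hs.t₁, hs.x', hs.Ahat, hs.D₁, hs.T₁, hs.T₂,
      hs.δ, hs.obs⟩
  · exact ⟨hr, htot, hts, hs.phase, hnext, hs.t₁, hs.x', hs.Ahat, hs.D₁, hs.T₁, hs.T₂, hs.δ, hs.obs⟩
  · exact ⟨hr, htot, hs.tstar, hs.phase, hnext, hs.t₁, hs.x', hs.Ahat, hs.D₁, hs.T₁, hs.T₂, hs.δ,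
      hs.obs⟩
  · exact ⟨hr, htot, hs.tstar, hs.phase, hnext, hs.t₁, hs.x', hs.Ahat, hs.D₁, hs.T₁, hs.T₂, hs.δ,
      hs.obs⟩
  · exact ⟨hr, htot, hs.tstar, hs.phase, hnext, hs.t₁, hs.x', hs.Ahat, hs.D₁, hs.T₁, hs.T₂,
      hs.update hj, hobs⟩

lemma const (s : AlgState n) : MeasState m fun _ : Ω => s :=
  ⟨measurable_const, fun _ _ => measurable_const, measurable_const, measurable_const,
    measurable_const, measurable_const, measurable_const, fun _ _ => measurable_const,
    measurable_const, measurable_const, measurable_const, measurable_const, measurable_const⟩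

lemma mono {m' : MeasurableSpace Ω} (hm : m ≤ m') {s : Ω → AlgState n}
    (hs : MeasState m s) : MeasState m' s :=
  ⟨hs.rounds.mono hm le_rfl, fun i k => (hs.total i k).mono hm le_rfl, hs.tstar.mono hm le_rfl,
    hs.phase.mono hm le_rfl, hs.next.mono hm le_rfl, hs.t₁.mono hm le_rfl, hs.x'.mono hm le_rfl,
    fun i k => (hs.Ahat i k).mono hm le_rfl, hs.D₁.mono hm le_rfl, hs.T₁.mono hm le_rfl,
    hs.T₂.mono hm le_rfl, hs.δ.mono hm le_rfl, hs.obs.mono hm le_rfl⟩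

end MeasState

/-- The strategy of round `t` is a measurable function of the past. -/
lemma measurable_algPlay [NeZero n]
    {nash : Matrix (Fin n) (Fin n) ℝ → (Fin n → ℝ) × (Fin n → ℝ)}
    (hnash : Measurable fun M : Fin n → Fin n → ℝ => nash (Matrix.of M)) (T : ℕ)
    (ℱ : Filtration ℕ m) {B : ℕ → Ω → Matrix (Fin n) (Fin n) ℝ} {j : ℕ → Ω → Fin n}
    (hB : ∀ t < T, ∀ i k, Measurable[ℱ (t + 1)] fun ω => B t ω i k)
    (hj : ∀ t < T, Measurable[ℱ (t + 1)] (j t)) {t : ℕ} (ht : t ≤ T) :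
    Measurable[ℱ t] fun ω => algPlay nash T (fun s => B s ω) (fun s => j s ω) t := by
  suffices h : MeasState (ℱ t)
      fun ω => algState nash T (fun s => B s ω) (fun s => j s ω) t from h.play
  induction t with
  | zero => exact MeasState.const _
  | succ t ih =>
    exact MeasState.step hnash T ((ih (by omega)).mono (ℱ.mono (Nat.le_succ t)))
      (hB t (by omega)) (hj t (by omega))

end Measurability

/-! ### Concentration of the empirical means -/

section Game

variable {Ω : Type*} {mΩ : MeasurableSpace Ω} {μ : Measure Ω}
  {ℱ : Filtration ℕ mΩ} {A : Matrix (Fin n) (Fin n) ℝ} {T : ℕ}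
  {B : ℕ → Ω → Matrix (Fin n) (Fin n) ℝ} {j : ℕ → Ω → Fin n} {y : ℕ → Ω → Fin n → ℝ}

namespace IsFullFeedbackGame

lemma measurable_matrix' (h : IsFullFeedbackGame μ ℱ A T B j y) {t : ℕ} (ht : t < T)
    (i k : Fin n) : Measurable fun ω => B t ω i k :=
  (h.measurable_matrix t ht i k).mono (ℱ.le _) le_rfl

lemma measurable_col' (h : IsFullFeedbackGame μ ℱ A T B j y) {t : ℕ} (ht : t < T) :
    Measurable (j t) :=
  (h.measurable_col t ht).mono (ℱ.le _) le_rfl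

/-- The event that some empirical mean up to the horizon is inaccurate. -/
def badEvent (A : Matrix (Fin n) (Fin n) ℝ) (T : ℕ) (B : ℕ → Ω → Matrix (Fin n) (Fin n) ℝ) :
    Set Ω :=
  ⋃ t ∈ Finset.Icc 1 T, ⋃ q ∈ (Finset.univ : Finset (Fin n × Fin n)),
    {ω | confWidth n T t < |empMean (fun s => B s ω) t q.1 q.2 - A q.1 q.2|}

lemma measurableSet_badEvent (h : IsFullFeedbackGame μ ℱ A T B j y) :
    MeasurableSet (badEvent A T B) := by
  refine Finset.measurableSet_biUnion _ fun t ht => Finset.measurableSet_biUnion _ fun q _ => ?_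
  have htT := (Finset.mem_Icc.1 ht).2
  simp_rw [empMean_apply]
  refine measurableSet_lt measurable_const ((Measurable.sub ?_ measurable_const).abs)
  exact (Finset.measurable_sum _ fun s hs =>
    h.measurable_matrix' (by have := Finset.mem_range.1 hs; omega) _ _).div_const _

variable [IsProbabilityMeasure μ]

/-- Each centred entry is sub-Gaussian with parameter 1/4 by Hoeffding's lemma, and the new matrix
is independent of the past, which determines the previous partial sum; so the parameters add. -/
lemma hasSubgaussianMGF_sum (h : IsFullFeedbackGame μ ℱ A T B j y) (i k : Fin n) {t : ℕ}
    (ht : t ≤ T) :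
    HasSubgaussianMGF (fun ω => ∑ s ∈ Finset.range t, (B s ω i k - A i k))
      (t * (‖(1 : ℝ) - 0‖₊ / 2) ^ 2) μ := by
  induction t with
  | zero => simp
  | succ t ih =>
    have htT : t < T := ht
    have hm : Measurable fun ω => B t ω i k := (h.measurable_matrix t htT i k).mono (ℱ.le _) le_rfl
    have h1 := hasSubgaussianMGF_of_mem_Icc (μ := μ) hm.aemeasurable
      (.of_forall fun ω => h.matrix_mem t htT ω i k)
    rw [h.mean t htT i k] at h1
    have hS : Measurable[ℱ t] fun ω => ∑ s ∈ Finset.range t, (B s ω i k - A i k) := by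
      refine Finset.measurable_sum _ fun s hs => ?_
      have hs' := Finset.mem_range.1 hs
      exact ((h.measurable_matrix s (by omega) i k).mono (ℱ.mono hs') le_rfl).sub measurable_const
    have hX : Measurable[MeasurableSpace.comap (fun ω (q : Fin n × Fin n) => B t ω q.1 q.2)
        inferInstance] fun ω => B t ω i k :=
      (measurable_pi_apply (i, k)).comp
        (comap_measurable fun ω (q : Fin n × Fin n) => B t ω q.1 q.2)
    have hind : IndepFun (fun ω => ∑ s ∈ Finset.range t, (B s ω i k - A i k))
        (fun ω => B t ω i k - A i k) μ := by
      rw [IndepFun_iff_Indep]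
      exact indep_of_indep_of_le_right (indep_of_indep_of_le_left (h.indep t htT).symm
        hS.comap_le)
        (hX.sub measurable_const).comap_le
    have h2 := (ih htT.le).add_of_indepFun h1 hind
    simp_rw [Finset.sum_range_succ]
    convert h2 using 1
    push_cast
    ring

lemma measure_deviation_le (h : IsFullFeedbackGame μ ℱ A T B j y) (hn : 2 ≤ n) (hT : 1 ≤ T)
    (i k : Fin n) {t : ℕ} (h1 : 1 ≤ t) (h2 : t ≤ T) :
    μ.real {ω | confWidth n T t < |empMean (fun s => B s ω) t i k - A i k|} ≤
      2 / ((n : ℝ) * T) ^ 2 := by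
  have ht : (0 : ℝ) < t := by exact_mod_cast h1
  have hL := log_pos_of_two_le hn hT
  have hw := confWidth_pos hn hT h1
  have hsq := mul_confWidth_sq hn hT h1
  have hnT : (0 : ℝ) < n * T := by
    have : 0 < n * T := Nat.mul_pos (by omega) (by omega)
    exact_mod_cast this
  have hS := h.hasSubgaussianMGF_sum i k h2
  have hε : 0 ≤ t * confWidth n T t := by positivity
  -- The exponent is -2 t w_t² = -8 log(nT). The weaker bound (nT)⁻² suffices for the union over n²
  -- entries and T rounds.
  have hexp : Real.exp (-(t * confWidth n T t) ^ 2 /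
      (2 * ((t * (‖(1 : ℝ) - 0‖₊ / 2) ^ 2 : NNReal) : ℝ))) ≤ 1 / ((n : ℝ) * T) ^ 2 := by
    have e1 : -(t * confWidth n T t) ^ 2 / (2 * ((t * (‖(1 : ℝ) - 0‖₊ / 2) ^ 2 : NNReal) : ℝ)) =
        -(8 * Real.log (n * T)) := by
      push_cast
      rw [sub_zero, norm_one, mul_pow]
      have e2 : 8 * Real.log (n * T) = 2 * (t * confWidth n T t ^ 2) := by rw [hsq]; ring
      rw [e2]
      field_simp
    rw [e1, ← Real.exp_log hnT, ← Real.exp_nat_mul, one_div, ← Real.exp_neg, Real.log_exp]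
    refine Real.exp_le_exp.2 ?_
    push_cast
    linarith
  have hsub : {ω | confWidth n T t < |empMean (fun s => B s ω) t i k - A i k|} ⊆
      {ω | t * confWidth n T t ≤ ∑ s ∈ Finset.range t, (B s ω i k - A i k)} ∪
      {ω | t * confWidth n T t ≤ (-fun ω => ∑ s ∈ Finset.range t, (B s ω i k - A i k)) ω} := by
    intro ω hω
    have e : empMean (fun s => B s ω) t i k - A i k =
        (∑ s ∈ Finset.range t, (B s ω i k - A i k)) / t := by
      rw [empMean_apply, Finset.sum_sub_distrib, Finset.sum_const, Finset.card_range, nsmul_eq_mul]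
      field_simp
    rw [Set.mem_ofPred_eq, e, abs_div, abs_of_pos ht, lt_div_iff₀ ht, mul_comm] at hω
    rcases le_abs.1 hω.le with h' | h'
    · exact Or.inl h'
    · exact Or.inr h'
  calc _ ≤ _ := measureReal_mono hsub
    _ ≤ _ := measureReal_union_le _ _
    _ ≤ 1 / ((n : ℝ) * T) ^ 2 + 1 / ((n : ℝ) * T) ^ 2 :=
      add_le_add ((hS.measure_ge_le hε).trans hexp) ((hS.neg.measure_ge_le hε).trans hexp)
    _ = _ := by ring

lemma measure_badEvent_le (h : IsFullFeedbackGame μ ℱ A T B j y) (hn : 2 ≤ n) (hT : 1 ≤ T) :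
    T * μ.real (badEvent A T B) ≤ 2 := by
  have hn' : (0 : ℝ) < n := by exact_mod_cast (show 0 < n by omega)
  have hT' : (0 : ℝ) < T := by exact_mod_cast (show 0 < T by omega)
  have h1 : μ.real (badEvent A T B) ≤ T * ((n * n : ℕ) * (2 / ((n : ℝ) * T) ^ 2)) := by
    refine (measureReal_biUnion_finset_le _ _).trans ?_
    refine (Finset.sum_le_card_nsmul _ _ ((n * n : ℕ) * (2 / ((n : ℝ) * T) ^ 2))
      fun t ht => ?_).trans ?_
    · obtain ⟨h1, h2⟩ := Finset.mem_Icc.1 ht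
      refine (measureReal_biUnion_finset_le _ _).trans ?_
      refine (Finset.sum_le_card_nsmul _ _ _
        fun q _ => h.measure_deviation_le hn hT q.1 q.2 h1 h2).trans ?_
      simp
    · simp
  calc _ ≤ T * (T * ((n * n : ℕ) * (2 / ((n : ℝ) * T) ^ 2))) := by gcongr
    _ = 2 := by
      push_cast
      field_simp

/-! ### From the realised columns to the mixed strategies of the adversary -/

/-- A factor known before round t can be pulled out of the conditional expectation, and the
conditional law of the column is y t. -/
lemma integral_mul_col_eq (h : IsFullFeedbackGame μ ℱ A T B j y) {t : ℕ} (ht : t < T)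
    {f : Ω → ℝ} (hf : Measurable[ℱ t] f) (hf1 : ∀ ω, f ω ∈ Set.Icc (0 : ℝ) 1) (k : Fin n) :
    ∫ ω, f ω * (j t ⁻¹' {k}).indicator (fun _ => (1 : ℝ)) ω ∂μ = ∫ ω, f ω * y t ω k ∂μ := by
  set g : Ω → ℝ := (j t ⁻¹' {k}).indicator (fun _ => (1 : ℝ)) with hg
  have hgm : MeasurableSet (j t ⁻¹' {k}) := h.measurable_col' ht (measurableSet_singleton k)
  have hgi : Integrable g μ := (integrable_const (1 : ℝ)).indicator hgm
  have h1 := condExp_stronglyMeasurable_mul_of_bound (ℱ.le t) (μ := μ) hf.stronglyMeasurable hgi 1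
    (.of_forall fun ω => by
      rw [Real.norm_eq_abs, abs_of_nonneg (hf1 ω).1]; exact (hf1 ω).2)
  have h2 : ∫ ω, (μ[f * g | ℱ t]) ω ∂μ = ∫ ω, (f * g) ω ∂μ := integral_condExp (ℱ.le t)
  have h3 : ∫ ω, f ω * g ω ∂μ = ∫ ω, (f * g) ω ∂μ := rfl
  rw [h3, ← h2]
  refine integral_congr_ae ?_
  filter_upwards [h1, h.col_law t ht k] with ω h4 h5
  rw [h4, Pi.mul_apply, h5]

lemma integral_payoff_eq (h : IsFullFeedbackGame μ ℱ A T B j y)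
    (hA : ∀ i k, A i k ∈ Set.Icc (0 : ℝ) 1) {t : ℕ} (ht : t < T) {x : Ω → Fin n → ℝ}
    (hx : Measurable[ℱ t] x) (hxs : ∀ ω, x ω ∈ stdSimplex ℝ (Fin n)) :
    Integrable (fun ω => x ω ⬝ᵥ (A *ᵥ y t ω)) μ ∧
      Integrable (fun ω => (x ω ᵥ* A) (j t ω)) μ ∧
      ∫ ω, x ω ⬝ᵥ (A *ᵥ y t ω) ∂μ = ∫ ω, (x ω ᵥ* A) (j t ω) ∂μ := by
  have hf : ∀ k, Measurable[ℱ t] fun ω => (x ω ᵥ* A) k := fun k => by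
    simp only [Matrix.vecMul, dotProduct]
    exact Finset.measurable_sum _ fun i _ => ((measurable_pi_apply i).comp hx).mul_const _
  have hf' : ∀ k, Measurable fun ω => (x ω ᵥ* A) k := fun k => (hf k).mono (ℱ.le t) le_rfl
  have hy : ∀ k, Measurable fun ω => y t ω k := fun k =>
    (measurable_pi_apply k).comp ((h.measurable_adv t ht).mono (ℱ.le t) le_rfl)
  have hf1 : ∀ k ω, (x ω ᵥ* A) k ∈ Set.Icc (0 : ℝ) 1 := fun k ω => vecMul_mem_Icc hA (hxs ω) k
  have e1 : ∀ ω, x ω ⬝ᵥ (A *ᵥ y t ω) = ∑ k, (x ω ᵥ* A) k * y t ω k := fun ω => by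
    rw [Matrix.dotProduct_mulVec, dotProduct]
  have e2 : ∀ ω, (x ω ᵥ* A) (j t ω) =
      ∑ k, (x ω ᵥ* A) k * (j t ⁻¹' {k}).indicator (fun _ => (1 : ℝ)) ω := fun ω => by
    rw [Finset.sum_eq_single (j t ω)]
    · rw [Set.indicator_of_mem (show ω ∈ j t ⁻¹' {j t ω} from rfl), mul_one]
    · intro k _ hk
      rw [Set.indicator_of_notMem fun hc => hk (Set.mem_preimage.1 hc).symm, mul_zero]
    · exact fun hc => absurd (Finset.mem_univ _) hc
  have i1 : ∀ k, Integrable (fun ω => (x ω ᵥ* A) k * y t ω k) μ := fun k =>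
    Integrable.of_mem_Icc 0 1 ((hf' k).mul (hy k)).aemeasurable (.of_forall fun ω => by
      have a1 := hf1 k ω
      have a2 := mem_Icc_of_mem_stdSimplex (h.adv_mem t ht ω) k
      exact ⟨mul_nonneg a1.1 a2.1, mul_le_one₀ a1.2 a2.1 a2.2⟩)
  have i2 : ∀ k, Integrable
      (fun ω => (x ω ᵥ* A) k * (j t ⁻¹' {k}).indicator (fun _ => (1 : ℝ)) ω) μ := fun k => by
    have hm : Measurable ((j t ⁻¹' {k}).indicator fun _ => (1 : ℝ)) :=
      measurable_const.indicator (h.measurable_col' ht (measurableSet_singleton k))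
    refine Integrable.of_mem_Icc 0 1 ((hf' k).mul hm).aemeasurable (.of_forall fun ω => ?_)
    by_cases hω : ω ∈ j t ⁻¹' {k}
    · rw [Set.indicator_of_mem hω, mul_one]; exact hf1 k ω
    · rw [Set.indicator_of_notMem hω, mul_zero]; exact ⟨le_rfl, zero_le_one⟩
  simp_rw [e1, e2]
  refine ⟨integrable_finsetSum _ fun k _ => i1 k, integrable_finsetSum _ fun k _ => i2 k, ?_⟩
  rw [integral_finsetSum _ fun k _ => i1 k, integral_finsetSum _ fun k _ => i2 k]
  exact Finset.sum_congr rfl fun k _ => (h.integral_mul_col_eq ht (hf k) (hf1 k) k).symm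

end IsFullFeedbackGame

/-! ### The expected regret -/

variable [IsProbabilityMeasure μ]

/-- The expected regret when there are at least two strategies. -/
lemma expected_regret_le [NeZero n] (hn : 2 ≤ n) (hT : 1 ≤ T)
    (hA : ∀ i k, A i k ∈ Set.Icc (0 : ℝ) 1) {xs ys : Fin n → ℝ} (hU : IsUniqueFullNash A xs ys)
    {nash : Matrix (Fin n) (Fin n) ℝ → (Fin n → ℝ) × (Fin n → ℝ)}
    (hnash : ∀ M, IsNash M (nash M).1 (nash M).2) (h : IsFullFeedbackGame μ ℱ A T B j y)
    {x : ℕ → Ω → Fin n → ℝ} (hxm : ∀ t < T, Measurable[ℱ t] (x t))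
    (hx : ∀ t ω, x t ω = algPlay nash T (fun s => B s ω) (fun s => j s ω) t) :
    (T : ℝ) * (xs ⬝ᵥ (A *ᵥ ys)) - ∑ t ∈ Finset.range T, ∫ ω, x t ω ⬝ᵥ (A *ᵥ y t ω) ∂μ ≤
      3 + exploreBound T A + 3 / 2 * Real.log (n * T) * callBound T A := by
  set v := xs ⬝ᵥ (A *ᵥ ys) with hv
  have hxs : ∀ t ω, x t ω ∈ stdSimplex ℝ (Fin n) := fun t ω => by
    rw [hx]; exact algPlay_mem hnash T _ _ t
  have hpay := fun t (ht : t ∈ Finset.range T) =>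
    h.integral_payoff_eq hA (Finset.mem_range.1 ht) (hxm t (Finset.mem_range.1 ht)) (hxs t)
  have hint : ∀ t ∈ Finset.range T, Integrable (fun ω => v - (x t ω ᵥ* A) (j t ω)) μ :=
    fun t ht => (integrable_const v).sub (hpay t ht).2.1
  have e1 : (T : ℝ) * v - ∑ t ∈ Finset.range T, ∫ ω, x t ω ⬝ᵥ (A *ᵥ y t ω) ∂μ =
      ∫ ω, ∑ t ∈ Finset.range T, (v - (x t ω ᵥ* A) (j t ω)) ∂μ := by
    have e : ∀ t ∈ Finset.range T, ∫ ω, (v - (x t ω ᵥ* A) (j t ω)) ∂μ =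
        v - ∫ ω, x t ω ⬝ᵥ (A *ᵥ y t ω) ∂μ := fun t ht => by
      rw [integral_sub (integrable_const v) (hpay t ht).2.1, integral_const,
        probReal_univ, one_smul, ← (hpay t ht).2.2]
    rw [integral_finsetSum _ hint, Finset.sum_congr rfl e, Finset.sum_sub_distrib, Finset.sum_const,
      Finset.card_range, nsmul_eq_mul]
  set R := 1 + exploreBound T A + 3 / 2 * Real.log (n * T) * callBound T A with hR
  have hL := log_pos_of_two_le hn hT
  have hR0 : 0 ≤ R := by
    have := hU.deltaMin_pos
    rw [hR, exploreBound, callBound]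
    positivity
  have hbad := h.measurableSet_badEvent
  -- The pathwise bound R holds off the bad event; on it each round loses at most 1, and T times its
  -- probability is at most 2.
  have hle : ∀ ω, ∑ t ∈ Finset.range T, (v - (x t ω ᵥ* A) (j t ω)) ≤
      R + (IsFullFeedbackGame.badEvent A T B).indicator (fun _ => (T : ℝ)) ω := by
    intro ω
    by_cases hω : ω ∈ IsFullFeedbackGame.badEvent A T B
    · rw [Set.indicator_of_mem hω]
      have : ∑ t ∈ Finset.range T, (v - (x t ω ᵥ* A) (j t ω)) ≤ T := by
        refine (Finset.sum_le_card_nsmul _ _ 1 fun t _ => ?_).trans (by simp)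
        have a1 := (value_mem_Icc hA hU.1.1 hU.1.2.1).2
        have a2 := (vecMul_mem_Icc hA (hxs t ω) (j t ω)).1
        linarith
      linarith
    · rw [Set.indicator_of_notMem hω, add_zero]
      have hgood : GoodPath nash T (fun s => B s ω) A xs ys := by
        refine ⟨hn, hT, hnash, hU, hA, fun t ht => h.matrix_mem t ht ω, fun t h1 h2 i k => ?_⟩
        by_contra hc
        refine hω (Set.mem_iUnion₂.2 ⟨t, Finset.mem_Icc.2 ⟨h1, h2⟩, Set.mem_iUnion₂.2
          ⟨(i, k), Finset.mem_univ _, not_le.1 hc⟩⟩)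
      simp_rw [hx]
      exact hgood.regret_le fun s => j s ω
  have hind : Integrable ((IsFullFeedbackGame.badEvent A T B).indicator fun _ => (T : ℝ)) μ :=
    (integrable_const (T : ℝ)).indicator hbad
  calc _ = _ := e1
    _ ≤ ∫ ω, (R + (IsFullFeedbackGame.badEvent A T B).indicator (fun _ => (T : ℝ)) ω) ∂μ :=
      integral_mono (integrable_finsetSum _ hint) ((integrable_const R).add hind) hle
    _ = R + T * μ.real (IsFullFeedbackGame.badEvent A T B) := by
      rw [integral_add (integrable_const R) hind, integral_const, probReal_univ, one_smul,
        integral_indicator_const _ hbad, smul_eq_mul, mul_comm]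
    _ ≤ R + 2 := by linarith [h.measure_badEvent_le hn hT]
    _ = _ := by rw [hR]; ring

end Game

/-- It absorbs the additive 3, made of 1 for the first round and 2 for the bad event, and raises the
constant of exploration from 768 to 770. -/
lemma three_le_scaled_log [NeZero n] {T : ℕ} (hn : 2 ≤ n) (hT : 1 ≤ T)
    {A : Matrix (Fin n) (Fin n) ℝ} (hA : ∀ i k, A i k ∈ Set.Icc (0 : ℝ) 1) (hd : 0 < deltaMin A) :
    3 ≤ 2 * ((n : ℝ) ^ 2 * n.factorial * Real.log (n * T) / deltaMin A) := by
  have h1 : 1 ≤ n.factorial / deltaMin A := (one_le_div hd).2 (deltaMin_le_factorial hA)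
  have h2 : (2 : ℝ) ≤ n := by exact_mod_cast hn
  have h3 : (4 : ℝ) ≤ (n : ℝ) ^ 2 := by nlinarith
  have h4 : (1 / 2 : ℝ) ≤ Real.log (n * T) := by
    have := log_two_le_log hn hT
    have := Real.log_two_gt_d9
    linarith
  calc (3 : ℝ) ≤ 2 * (4 * (1 / 2) * 1) := by norm_num
    _ ≤ 2 * ((n : ℝ) ^ 2 * Real.log (n * T) * (n.factorial / deltaMin A)) := by gcongr
    _ = _ := by ring

end MatrixGame

theorem mainTheorem8 :
    ∃ c₁ c₂ : ℝ, 0 < c₁ ∧ 0 < c₂ ∧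
      ∀ (n T : ℕ), 1 ≤ T →
      ∀ (A : Matrix (Fin n) (Fin n) ℝ), (∀ i k, A i k ∈ Set.Icc (0 : ℝ) 1) →
      ∀ (xs ys : Fin n → ℝ), MatrixGame.IsUniqueFullNash A xs ys →
      -- any (measurable) rule that picks a Nash equilibrium of each matrix
      ∀ (nash : Matrix (Fin n) (Fin n) ℝ → (Fin n → ℝ) × (Fin n → ℝ)),
        (∀ M, MatrixGame.IsNash M (nash M).1 (nash M).2) →
        (Measurable fun M : Fin n → Fin n → ℝ => nash (Matrix.of M)) →
      ∀ (Ω : Type*) (mΩ : MeasurableSpace Ω) (μ : Measure Ω), IsProbabilityMeasure μ →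
      ∀ (ℱ : Filtration ℕ mΩ) (B : ℕ → Ω → Matrix (Fin n) (Fin n) ℝ) (j : ℕ → Ω → Fin n)
        (y : ℕ → Ω → Fin n → ℝ), MatrixGame.IsFullFeedbackGame μ ℱ A T B j y →
      ∀ (x : ℕ → Ω → Fin n → ℝ),
        (∀ t ω, x t ω = MatrixGame.algPlay nash T (fun s => B s ω) (fun s => j s ω) t) →
        (∀ t < T, Integrable (fun ω => x t ω ⬝ᵥ (A *ᵥ y t ω)) μ) ∧
        (T : ℝ) * (xs ⬝ᵥ (A *ᵥ ys)) - ∑ t ∈ Finset.range T, ∫ ω, x t ω ⬝ᵥ (A *ᵥ y t ω) ∂μ ≤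
          c₁ * (n : ℝ) ^ 2 * (n.factorial : ℝ) * Real.log ((n : ℝ) * T) / MatrixGame.deltaMin A +
          c₂ * (n : ℝ) ^ 2 * (n.factorial : ℝ) * Real.log ((n : ℝ) * T) ^ 2 /
            |MatrixGame.cramerD A| := by
  refine ⟨770, 315, by norm_num, by norm_num, ?_⟩
  intro n T hT A hA xs ys hU nash hnash hmeas Ω mΩ μ hμ ℱ B j y h x hx
  have := hU.neZero
  have hxs : ∀ t ω, x t ω ∈ stdSimplex ℝ (Fin n) := fun t ω => by
    rw [hx]; exact MatrixGame.algPlay_mem hnash T _ _ t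
  have hxm : ∀ t < T, Measurable[ℱ t] (x t) := fun t ht => by
    rw [show x t = _ from funext (hx t)]
    exact MatrixGame.measurable_algPlay hmeas T ℱ h.measurable_matrix h.measurable_col ht.le
  refine ⟨fun t ht => (h.integral_payoff_eq hA ht (hxm t ht) (hxs t)).1, ?_⟩
  have hd := hU.deltaMin_pos
  -- For n = 1 the logarithm may vanish, so additive constants cannot be absorbed; but then there is
  -- only one strategy and the regret is exactly 0.
  rcases Nat.lt_or_ge n 2 with hn | hn
  · obtain rfl : n = 1 := by have := NeZero.ne n; omega
    have hone : ∀ z ∈ stdSimplex ℝ (Fin 1), z = fun _ => 1 := fun z hz => by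
      funext i
      have := hz.2
      rw [Fin.sum_univ_one] at this
      rw [Subsingleton.elim i 0, this]
    have hsum : ∑ t ∈ Finset.range T, ∫ ω, x t ω ⬝ᵥ (A *ᵥ y t ω) ∂μ =
        ∑ t ∈ Finset.range T, xs ⬝ᵥ (A *ᵥ ys) := by
      refine Finset.sum_congr rfl fun t ht => ?_
      have : (fun ω => x t ω ⬝ᵥ (A *ᵥ y t ω)) = fun _ => xs ⬝ᵥ (A *ᵥ ys) := by
        funext ω
        rw [hone _ (hxs t ω), hone _ (h.adv_mem t (Finset.mem_range.1 ht) ω), hone _ hU.1.1,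
          hone _ hU.1.2.1]
      rw [this, integral_const, probReal_univ, one_smul]
    rw [hsum, Finset.sum_const, Finset.card_range, nsmul_eq_mul, sub_self]
    have hL : 0 ≤ Real.log (((1 : ℕ) : ℝ) * T) := by
      rw [Nat.cast_one, one_mul]
      exact Real.log_natCast_nonneg T
    positivity
  · refine (MatrixGame.expected_regret_le hn hT hA hU hnash h hxm hx).trans ?_
    have h3 := MatrixGame.three_le_scaled_log hn hT hA hd
    have e : 3 / 2 * Real.log ((n : ℝ) * T) * MatrixGame.callBound T A =
        315 * (n : ℝ) ^ 2 * (n.factorial : ℝ) * Real.log ((n : ℝ) * T) ^ 2 /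
            |MatrixGame.cramerD A| := by
      rw [MatrixGame.callBound]; ring
    have e2 : 770 * (n : ℝ) ^ 2 * (n.factorial : ℝ) * Real.log ((n : ℝ) * T) /
        MatrixGame.deltaMin A =
        770 * ((n : ℝ) ^ 2 * n.factorial * Real.log (n * T) / MatrixGame.deltaMin A) := by ring
    rw [e, e2, MatrixGame.exploreBound]
    linarith
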